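/- Let $n,k,\ell\ge 0$. For a partition $\mu$, let $S_\mu(x_1,\dots,x_n)$ be the Schur polynomial, and let the hook Schur polynomial $HS_\mu(y_1,\dots,y_k;z_1,\dots,z_\ell)=\sum_T\prod_{c\in\mu}w_{T(c)}$ be the generating function of the $(k,\ell)$-semistandard tableaux $T$ of shape $\mu$: fillings by $1<\dots<k<1'<\dots<\ell'$, weakly increasing along rows and columns, in which no unprimed symbol is repeated in a column and no primed symbol is repeated in a row; here $w_j=y_j$ and $w_{j'}=z_j$. Every symmetric polynomial $f\in\mathbb C[x_1,\dots,x_n]$ is uniquely $f=\sum_\mu m_\mu S_\mu(x_1,\dots,x_n)$, the sum being over partitions $\mu$ with at most $n$ parts, and one puts $$\digamma f(y_1,\dots,y_k;z_1,\dots,z_\ell)=\sum_\mu m_\mu\,HS_\mu(y_1,\dots,y_k;z_1,\dots,z_\ell).$$ Let $\langle\cdot,\cdot\rangle$ be the bilinear form on symmetric polynomials in $x_1,\dots,x_n$ for which the $S_\mu(x_1,\dots,x_n)$ ($\mu$ with at most $n$ parts) are orthonormal, applied coefficientwise to formal power series in the $y_j,z_j$ whose coefficients are symmetric polynomials in $x_1,\dots,x_n$.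 Theorem (integral formula for $\digamma$). If $f(x_1,\dots,x_n)$ is symmetric, then, as formal power series in the $y_j$ and $z_j$, $$\digamma f(y_1,\dots,y_k;z_1,\dots,z_\ell)=\Big\langle f,\ \prod_{i=1}^n\prod_{j=1}^\ell(1+x_iz_j)\prod_{i=1}^n\prod_{j=1}^k(1-x_iy_j)^{-1}\Big\rangle ,$$ and for all complex numbers $y_1,\dots,y_k,z_1,\dots,z_\ell$ with $|y_j|<1$ for every $j$, $$\digamma f(y_1,\dots,y_k;z_1,\dots,z_\ell)=\oint_T f(x_1,\dots,x_n)\,\prod_{i=1}^n\Big(x_i^{\,k-\ell}\,\frac{\prod_{j=1}^\ell(x_i+z_j)}{\prod_{j=1}^k(x_i-y_j)}\Big)\,d\nu ,$$ where $T$ is the torus $|x_i|=1$, $i=1,\dots,n$, and $$d\nu=(2\pi\sqrt{-1})^{-n}(n!)^{-1}\prod_{1\le i\ne j\le n}\Big(1-\frac{x_i}{x_j}\Big)\frac{dx_1}{x_1}\wedge\cdots\wedge\frac{dx_n}{x_n}.$$ -/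

import Mathlib

open MvPolynomial

namespace HookSchur

/-! ### Tableaux and the two families of polynomials -/

/-- Semistandard fillings of a Young diagram by `1, …, n`: weakly increasing along rows, strictly
increasing down columns.  A cell is a pair `(row, column)`. -/
def IsSemistandard {n : ℕ} {μ : YoungDiagram} (T : μ.cells → Fin n) : Prop :=
  (∀ c d : μ.cells, c.1.1 = d.1.1 → c.1.2 ≤ d.1.2 → T c ≤ T d) ∧
  (∀ c d : μ.cells, c.1.2 = d.1.2 → c.1.1 < d.1.1 → T c < T d)

open Classical in
/-- The Schur polynomial `S_μ(x₁, …, xₙ)`, as the generating function of semistandard tableaux. -/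
noncomputable def schurPoly (n : ℕ) (μ : YoungDiagram) : MvPolynomial (Fin n) ℂ :=
  ∑ T : μ.cells → Fin n with IsSemistandard T, ∏ c, X (T c)

/-! ### Symmetry of Schur polynomials -/

section Symmetry

variable {n : ℕ} {μ : YoungDiagram}

/-- The number of entries smaller than `v` in row `i`. -/
def rowCount (T : μ.cells → Fin n) (v i : ℕ) : ℕ :=
  (Finset.univ.filter fun c : μ.cells => c.1.1 = i ∧ (T c).val < v).card

theorem mem_iff_lt_card_of_isLowerSet (s : Finset ℕ) (hs : ∀ x ∈ s, ∀ y ≤ x, y ∈ s) (j : ℕ) :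
    j ∈ s ↔ j < s.card := by
  obtain ⟨m, hm⟩ : ∃ m, s = Finset.range m := by
    obtain ⟨m, hm, hmin⟩ : ∃ m, m ∉ s ∧ ∀ k < m, k ∈ s := by
      have h : ∃ m, m ∉ s := Infinite.exists_notMem_finset s
      exact ⟨Nat.find h, Nat.find_spec h, fun k hk => not_not.1 (Nat.find_min h hk)⟩
    refine ⟨m, Finset.ext fun x => ?_⟩
    rw [Finset.mem_range]
    exact ⟨fun hx => not_le.1 fun hle => hm (hs x hx m hle), hmin x⟩
  subst hm
  simp

theorem lt_rowCount_iff {T : μ.cells → Fin n} (hT : IsSemistandard T) (v i j : ℕ) :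
    j < rowCount T v i ↔ ∃ h : (i, j) ∈ μ.cells, (T ⟨(i, j), h⟩).val < v := by
  have key := mem_iff_lt_card_of_isLowerSet
    ((Finset.univ.filter fun c : μ.cells => c.1.1 = i ∧ (T c).val < v).image fun c => c.1.2) ?_ j
  · rw [Finset.card_image_of_injOn] at key
    · rw [rowCount, ← key]
      simp only [Finset.mem_image, Finset.mem_filter, Finset.mem_univ, true_and]
      constructor
      · rintro ⟨⟨⟨a, b⟩, hc⟩, ⟨h1, h2⟩, h3⟩
        simp only at h1 h3
        subst h1 h3
        exact ⟨hc, h2⟩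
      · rintro ⟨h, h2⟩
        exact ⟨⟨(i, j), h⟩, ⟨rfl, h2⟩, rfl⟩
    · rintro ⟨⟨a, b⟩, hc⟩ h1 ⟨⟨a', b'⟩, hc'⟩ h2 h3
      simp_all
  · intro x hx y hy
    simp only [Finset.mem_image, Finset.mem_filter, Finset.mem_univ, true_and] at hx ⊢
    obtain ⟨⟨⟨a, b⟩, hc⟩, ⟨h1, h2⟩, h3⟩ := hx
    simp only at h1 h3
    subst h1 h3
    have hm : (a, y) ∈ μ.cells := μ.isLowerSet (show (a, y) ≤ (a, b) from ⟨le_rfl, hy⟩) hc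
    refine ⟨⟨(a, y), hm⟩, ⟨rfl, lt_of_le_of_lt ?_ h2⟩, rfl⟩
    exact hT.1 ⟨(a, y), hm⟩ ⟨(a, b), hc⟩ rfl hy

theorem rowCount_mono (T : μ.cells → Fin n) {v w : ℕ} (h : v ≤ w) (i : ℕ) :
    rowCount T v i ≤ rowCount T w i :=
  Finset.card_le_card fun c hc => by
    simp only [Finset.mem_filter, Finset.mem_univ, true_and] at hc ⊢
    exact ⟨hc.1, by omega⟩

theorem rowCount_succ_le {T : μ.cells → Fin n} (hT : IsSemistandard T) (v i : ℕ) :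
    rowCount T (v + 1) (i + 1) ≤ rowCount T v i := by
  by_contra! hlt
  obtain ⟨h, hv⟩ := (lt_rowCount_iff hT _ _ _).1 hlt
  have hm : (i, rowCount T v i) ∈ μ.cells :=
    μ.isLowerSet (show (i, rowCount T v i) ≤ (i + 1, rowCount T v i) from
      ⟨Nat.le_succ i, le_rfl⟩) h
  have h2 : (T ⟨_, hm⟩).val < (T ⟨_, h⟩).val :=
    hT.2 ⟨_, hm⟩ ⟨_, h⟩ rfl (Nat.lt_succ_self i)
  exact lt_irrefl _ ((lt_rowCount_iff hT v i _).2 ⟨hm, by omega⟩)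

theorem rowCount_eq_zero (T : μ.cells → Fin n) (v : ℕ) {i : ℕ} (hi : μ.colLen 0 ≤ i) :
    rowCount T v i = 0 := by
  rw [rowCount, Finset.card_eq_zero, Finset.filter_eq_empty_iff]
  rintro ⟨⟨a, b⟩, hc⟩ - ⟨rfl, -⟩
  have h0 : (a, 0) ∈ μ := μ.isLowerSet (show (a, 0) ≤ (a, b) from ⟨le_rfl, Nat.zero_le b⟩) hc
  rw [YoungDiagram.mem_iff_lt_colLen] at h0
  simp only at hi
  omega

theorem sum_rowCount (T : μ.cells → Fin n) (v : ℕ) :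
    ∑ i ∈ Finset.range (μ.colLen 0), rowCount T v i =
      (Finset.univ.filter fun c : μ.cells => (T c).val < v).card := by
  rw [Finset.card_eq_sum_card_fiberwise (f := fun c : μ.cells => c.1.1)
    (t := Finset.range (μ.colLen 0))]
  · refine Finset.sum_congr rfl fun i _ => ?_
    rw [rowCount, Finset.filter_filter]
    congr 1
    ext c
    simp [and_comm]
  · rintro ⟨⟨a, b⟩, hc⟩ -
    have h0 : (a, 0) ∈ μ := μ.isLowerSet (show (a, 0) ≤ (a, b) from ⟨le_rfl, Nat.zero_le b⟩) hc
    simpa using YoungDiagram.mem_iff_lt_colLen.1 h0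

/-- Lower end of the range in which the number of entries `≤ a` of row `i` may vary when all other
entries are fixed. -/
def rowLo (T : μ.cells → Fin n) (a i : ℕ) : ℕ := max (rowCount T a i) (rowCount T (a + 2) (i + 1))

/-- Upper end of that range. -/
def rowHi (T : μ.cells → Fin n) (a : ℕ) : ℕ → ℕ
  | 0 => rowCount T (a + 2) 0
  | i + 1 => min (rowCount T (a + 2) (i + 1)) (rowCount T a i)

/-- The reflected row count. -/
def rowFlip (T : μ.cells → Fin n) (a i : ℕ) : ℕ :=
  rowLo T a i + rowHi T a i - rowCount T (a + 1) i

theorem rowLo_le {T : μ.cells → Fin n} (hT : IsSemistandard T) (a i : ℕ) :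
    rowLo T a i ≤ rowCount T (a + 1) i :=
  max_le (rowCount_mono T (Nat.le_succ a) i) (rowCount_succ_le hT (a + 1) i)

theorem le_rowHi {T : μ.cells → Fin n} (hT : IsSemistandard T) (a i : ℕ) :
    rowCount T (a + 1) i ≤ rowHi T a i := by
  cases i with
  | zero => exact rowCount_mono T (Nat.le_succ _) 0
  | succ i => exact le_min (rowCount_mono T (Nat.le_succ _) _) (rowCount_succ_le hT a i)

theorem sum_rowLo_add_rowHi (T : μ.cells → Fin n) (a : ℕ) :
    ∑ i ∈ Finset.range (μ.colLen 0), (rowLo T a i + rowHi T a i) =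
      ∑ i ∈ Finset.range (μ.colLen 0), (rowCount T a i + rowCount T (a + 2) i) := by
  have h : ∀ r, ∑ i ∈ Finset.range r, (rowLo T a i + rowHi T a i) + rowHi T a r =
      ∑ i ∈ Finset.range r, (rowCount T a i + rowCount T (a + 2) i) + rowCount T (a + 2) r := by
    intro r
    induction r with
    | zero => simp [rowHi]
    | succ r ih =>
      rw [Finset.sum_range_succ, Finset.sum_range_succ]
      have : rowLo T a r + rowHi T a (r + 1) = rowCount T a r + rowCount T (a + 2) (r + 1) := by
        simp only [rowLo, rowHi]
        omega
      omega
  have h1 := h (μ.colLen 0)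
  have h2 := rowCount_eq_zero T (a + 2) (le_refl (μ.colLen 0))
  have h3 : rowHi T a (μ.colLen 0) = 0 := by
    cases hr : μ.colLen 0 with
    | zero => rw [hr] at h2; simpa [rowHi] using h2
    | succ r => rw [hr] at h2; simp [rowHi, h2]
  omega

/-- The Bender–Knuth move exchanging the multiplicities of `a` and `b = a + 1`. -/
def flip (a b : Fin n) (T : μ.cells → Fin n) (c : μ.cells) : Fin n :=
  if T c = a ∨ T c = b then (if c.1.2 < rowFlip T a c.1.1 then a else b) else T c

variable {a b : Fin n}

theorem flip_eq_or (T : μ.cells → Fin n) (c : μ.cells) :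
    (flip a b T c = a ∨ flip a b T c = b) ↔ (T c = a ∨ T c = b) := by
  unfold flip; split_ifs <;> simp_all

theorem flip_of_ne {T : μ.cells → Fin n} {c : μ.cells} (h : ¬ (T c = a ∨ T c = b)) :
    flip a b T c = T c := by
  simp [flip, h]

theorem rowFlip_bounds {T : μ.cells → Fin n} (hT : IsSemistandard T) (a i : ℕ) :
    rowLo T a i ≤ rowFlip T a i ∧ rowFlip T a i ≤ rowHi T a i := by
  have h1 := rowLo_le hT a i
  have h2 := le_rowHi hT a i
  unfold rowFlip
  omega

theorem rowHi_le (T : μ.cells → Fin n) (a i : ℕ) : rowHi T a i ≤ rowCount T (a + 2) i := by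
  cases i with
  | zero => exact le_rfl
  | succ i => exact min_le_left _ _

theorem flip_isSemistandard (hab : b.val = a.val + 1) {T : μ.cells → Fin n}
    (hT : IsSemistandard T) : IsSemistandard (flip a b T) := by
  have hlt : a < b := by rw [Fin.lt_def]; omega
  constructor
  · intro c d hr hc
    have hle := hT.1 c d hr hc
    unfold flip
    rw [hr]
    split_ifs <;> simp only [Fin.le_def, Fin.lt_def, Fin.ext_iff] at * <;> omega
  · intro c d hc hr
    have hlt' := hT.2 c d hc hr
    by_cases h1 : T c = a ∨ T c = b
    · by_cases h2 : T d = a ∨ T d = b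
      · have hca : T c = a := by
          rcases h1 with h1 | h1
          · exact h1
          · rcases h2 with h2 | h2 <;>
              simp only [Fin.lt_def, Fin.ext_iff] at * <;> omega
        have hdb : T d = b := by
          rcases h2 with h2 | h2
          · rw [hca, h2] at hlt'; exact absurd hlt' (lt_irrefl _)
          · exact h2
        obtain ⟨⟨i, j⟩, hcm⟩ := c
        obtain ⟨⟨i', j'⟩, hdm⟩ := d
        simp only at hc hr
        subst hc
        have hi : i' = i + 1 := by
          by_contra hne
          have hm : (i + 1, j) ∈ μ.cells :=
            μ.isLowerSet (show (i + 1, j) ≤ (i', j) from ⟨by simp only; omega, le_rfl⟩) hdm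
          have e1 := hT.2 ⟨(i, j), hcm⟩ ⟨(i + 1, j), hm⟩ rfl (Nat.lt_succ_self i)
          have e2 := hT.2 ⟨(i + 1, j), hm⟩ ⟨(i', j), hdm⟩ rfl (by simp only; omega)
          simp only [Fin.lt_def, Fin.ext_iff] at *
          omega
        subst hi
        have hj1 : j < rowFlip T a i := by
          refine lt_of_lt_of_le ?_ (rowFlip_bounds hT a i).1
          refine lt_of_lt_of_le ?_ (le_max_right _ _)
          exact (lt_rowCount_iff hT _ _ _).2 ⟨hdm, by rw [hdb]; omega⟩
        have hj2 : ¬ j < rowFlip T a (i + 1) := by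
          intro hj
          have h3 := lt_of_lt_of_le hj ((rowFlip_bounds hT a (i + 1)).2.trans (min_le_right _ _))
          obtain ⟨_, h4⟩ := (lt_rowCount_iff hT _ _ _).1 h3
          rw [hca] at h4
          exact lt_irrefl _ h4
        simp only [flip, hca, hdb, true_or, or_true, if_true, hj1, hj2, if_false]
        exact hlt
      · rw [flip_of_ne h2]
        unfold flip
        split_ifs <;> simp only [Fin.lt_def, Fin.ext_iff] at * <;> omega
    · rw [flip_of_ne h1]
      unfold flip
      split_ifs <;> simp only [Fin.lt_def, Fin.ext_iff] at * <;> omega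

theorem rowCount_flip_of_le (hab : b.val = a.val + 1) (T : μ.cells → Fin n) {v : ℕ}
    (hv : v ≠ a.val + 1) (i : ℕ) : rowCount (flip a b T) v i = rowCount T v i := by
  unfold rowCount
  congr 1
  ext c
  simp only [Finset.mem_filter, Finset.mem_univ, true_and, and_congr_right_iff]
  intro _
  unfold flip
  split_ifs <;> simp only [Fin.ext_iff] at * <;> omega

theorem rowCount_flip (hab : b.val = a.val + 1) {T : μ.cells → Fin n}
    (hT : IsSemistandard T) (i : ℕ) : rowCount (flip a b T) (a + 1) i = rowFlip T a i := by
  have hb := rowFlip_bounds hT a i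
  have hL : rowCount T a i ≤ rowFlip T a i := (le_max_left _ _).trans hb.1
  have hP : rowFlip T a i ≤ rowCount T (a + 2) i := hb.2.trans (rowHi_le T a i)
  refine eq_of_forall_lt_iff fun j => ?_
  rw [lt_rowCount_iff (flip_isSemistandard hab hT)]
  constructor
  · rintro ⟨h, h2⟩
    by_cases hc : T ⟨(i, j), h⟩ = a ∨ T ⟨(i, j), h⟩ = b
    · by_contra hj
      simp only [flip, hc, if_true, hj, if_false] at h2
      omega
    · rw [flip_of_ne hc] at h2
      refine lt_of_lt_of_le ((lt_rowCount_iff hT _ _ _).2 ⟨h, ?_⟩) hL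
      simp only [Fin.ext_iff] at hc
      omega
  · intro hj
    obtain ⟨h, h2⟩ := (lt_rowCount_iff hT _ _ _).1 (lt_of_lt_of_le hj hP)
    refine ⟨h, ?_⟩
    by_cases hc : T ⟨(i, j), h⟩ = a ∨ T ⟨(i, j), h⟩ = b
    · simp [flip, hc, hj]
    · rw [flip_of_ne hc]
      simp only [Fin.ext_iff] at hc
      omega

theorem flip_flip (hab : b.val = a.val + 1) {T : μ.cells → Fin n}
    (hT : IsSemistandard T) : flip a b (flip a b T) = T := by
  have hlo : ∀ i, rowLo (flip a b T) a i = rowLo T a i := fun i => by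
    simp only [rowLo]
    rw [rowCount_flip_of_le hab T (by omega), rowCount_flip_of_le hab T (by omega)]
  have hhi : ∀ i, rowHi (flip a b T) a i = rowHi T a i := fun i => by
    cases i with
    | zero => exact rowCount_flip_of_le hab T (by omega) _
    | succ i =>
      simp only [rowHi]
      rw [rowCount_flip_of_le hab T (by omega), rowCount_flip_of_le hab T (by omega)]
  have hfl : ∀ i, rowFlip (flip a b T) a i = rowCount T (a + 1) i := fun i => by
    have h1 := rowLo_le hT a i
    have h2 := le_rowHi hT a i
    rw [rowFlip, hlo, hhi, rowCount_flip hab hT, rowFlip]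
    omega
  funext c
  by_cases hc : T c = a ∨ T c = b
  · rw [flip, if_pos ((flip_eq_or T c).2 hc), hfl]
    obtain ⟨⟨i, j⟩, hm⟩ := c
    have := lt_rowCount_iff hT (a + 1) i j
    rcases hc with hc | hc
    · rw [if_pos, hc]
      exact this.2 ⟨hm, by rw [hc]; omega⟩
    · rw [if_neg, hc]
      intro h
      obtain ⟨_, h2⟩ := this.1 h
      rw [hc] at h2
      omega
  · rw [flip_of_ne, flip_of_ne hc]
    rwa [flip_eq_or]

theorem card_flip_lt (hab : b.val = a.val + 1) {T : μ.cells → Fin n} (hT : IsSemistandard T) :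
    (Finset.univ.filter fun c => (flip a b T c).val < a + 1).card +
      (Finset.univ.filter fun c => (T c).val < a + 1).card =
      (Finset.univ.filter fun c => (T c).val < a).card +
      (Finset.univ.filter fun c => (T c).val < a + 2).card := by
  rw [← sum_rowCount, ← sum_rowCount, ← sum_rowCount, ← sum_rowCount, ← Finset.sum_add_distrib,
    ← Finset.sum_add_distrib, ← sum_rowLo_add_rowHi]
  refine Finset.sum_congr rfl fun i _ => ?_
  have h1 := rowLo_le hT a i
  have h2 := le_rowHi hT a i
  rw [rowCount_flip hab hT, rowFlip]
  omega

theorem card_eq_add (T : μ.cells → Fin n) (v : Fin n) :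
    (Finset.univ.filter fun c => (T c).val < v + 1).card =
      (Finset.univ.filter fun c => (T c).val < v).card +
      (Finset.univ.filter fun c => T c = v).card := by
  rw [← Finset.card_union_of_disjoint]
  · congr 1
    ext c
    simp only [Finset.mem_filter, Finset.mem_univ, true_and, Finset.mem_union, Fin.ext_iff]
    omega
  · rw [Finset.disjoint_filter]
    intro c _ h1 h2
    rw [h2] at h1
    exact lt_irrefl _ h1

theorem card_flip_eq (hab : b.val = a.val + 1) {T : μ.cells → Fin n} (hT : IsSemistandard T)
    (v : Fin n) :
    (Finset.univ.filter fun c => flip a b T c = v).card =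
      (Finset.univ.filter fun c => T c = Equiv.swap a b v).card := by
  have main := card_flip_lt hab hT
  have e0 : (Finset.univ.filter fun c => (flip a b T c).val < a).card =
      (Finset.univ.filter fun c => (T c).val < a).card := by
    rw [← sum_rowCount, ← sum_rowCount]
    exact Finset.sum_congr rfl fun i _ => rowCount_flip_of_le hab T (by omega) i
  have e2 : (Finset.univ.filter fun c => (flip a b T c).val < a + 2).card =
      (Finset.univ.filter fun c => (T c).val < a + 2).card := by
    rw [← sum_rowCount, ← sum_rowCount]
    exact Finset.sum_congr rfl fun i _ => rowCount_flip_of_le hab T (by omega) i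
  have f1 := card_eq_add (flip a b T) a
  have f2 := card_eq_add (flip a b T) b
  have f3 := card_eq_add T a
  have f4 := card_eq_add T b
  rw [hab, show a.val + 1 + 1 = a.val + 2 from rfl] at f2 f4
  by_cases h1 : v = a
  · subst h1
    rw [Equiv.swap_apply_left]
    omega
  by_cases h2 : v = b
  · subst h2
    rw [Equiv.swap_apply_right]
    omega
  rw [Equiv.swap_apply_of_ne_of_ne h1 h2]
  congr 1
  ext c
  simp only [Finset.mem_filter, Finset.mem_univ, true_and]
  unfold flip
  split_ifs <;> grind

theorem prod_flip (hab : b.val = a.val + 1) {T : μ.cells → Fin n} (hT : IsSemistandard T) :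
    ∏ c, (X (Equiv.swap a b (flip a b T c)) : MvPolynomial (Fin n) ℂ) = ∏ c, X (T c) := by
  have h1 : ∀ (U : μ.cells → Fin n) (g : Fin n → MvPolynomial (Fin n) ℂ),
      ∏ c, g (U c) = ∏ v, g v ^ (Finset.univ.filter fun c => U c = v).card := by
    intro U g
    rw [← Finset.prod_fiberwise_of_maps_to (s := Finset.univ) (t := Finset.univ) (g := U)
      (fun _ _ => Finset.mem_univ _)]
    refine Finset.prod_congr rfl fun v _ => ?_
    rw [← Finset.prod_const]
    refine Finset.prod_congr rfl fun c hc => ?_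
    rw [(Finset.mem_filter.1 hc).2]
  rw [h1 _ fun v => X (Equiv.swap a b v), h1 T fun v => X v,
    ← Equiv.prod_comp (Equiv.swap a b)]
  refine Finset.prod_congr rfl fun v _ => ?_
  rw [Equiv.swap_apply_self, card_flip_eq hab hT, Equiv.swap_apply_self]

theorem rename_swap_schurPoly (hab : b.val = a.val + 1) :
    rename (Equiv.swap a b) (schurPoly n μ) = schurPoly n μ := by
  classical
  simp only [schurPoly, map_sum, map_prod, rename_X]
  refine Finset.sum_bij' (fun T _ => flip a b T) (fun T _ => flip a b T) ?_ ?_ ?_ ?_ ?_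
  · intro T hT
    simpa using flip_isSemistandard hab (by simpa using hT)
  · intro T hT
    simpa using flip_isSemistandard hab (by simpa using hT)
  · intro T hT
    exact flip_flip hab (by simpa using hT)
  · intro T hT
    exact flip_flip hab (by simpa using hT)
  · intro T hT
    have hT' : IsSemistandard T := by simpa using hT
    have h := prod_flip hab (flip_isSemistandard hab hT')
    rwa [flip_flip hab hT'] at h

theorem schurPoly_isSymmetric (n : ℕ) (μ : YoungDiagram) : (schurPoly n μ).IsSymmetric := by
  intro e
  cases n with
  | zero => rw [Subsingleton.elim e (Equiv.refl _)]; simp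
  | succ m =>
    have he : e ∈ Submonoid.closure
        (Set.range fun i : Fin m => Equiv.swap i.castSucc i.succ) := by
      rw [Equiv.Perm.mclosure_swap_castSucc_succ]; trivial
    induction he using Submonoid.closure_induction with
    | mem x hx =>
      obtain ⟨i, rfl⟩ := hx
      exact rename_swap_schurPoly (by simp)
    | one => simp
    | mul x y _ _ hx hy =>
      rw [Equiv.Perm.coe_mul, ← rename_rename, hy, hx]

end Symmetry

/-! ### Schur polynomials form a basis of the symmetric polynomials -/

section Basis

variable {n : ℕ} {μ : YoungDiagram}

/-- The exponent vector `(μ₁, …, μₙ)`. -/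
noncomputable def weight (n : ℕ) (μ : YoungDiagram) : Fin n →₀ ℕ :=
  Finsupp.equivFunOnFinite.symm fun i => μ.rowLen i

/-- The exponent vector of a filling. -/
noncomputable def content (T : μ.cells → Fin n) : Fin n →₀ ℕ := ∑ c, Finsupp.single (T c) 1

theorem content_apply (T : μ.cells → Fin n) (v : Fin n) :
    content T v = (Finset.univ.filter fun c => T c = v).card := by
  rw [content, Finsupp.finsetSum_apply, Finset.card_filter]
  exact Finset.sum_congr rfl fun c _ => Finsupp.single_apply

theorem prod_X_eq (T : μ.cells → Fin n) :
    ∏ c, (X (T c) : MvPolynomial (Fin n) ℂ) = monomial (content T) 1 := by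
  simp [content, monomial_sum_one, X]

theorem card_row (μ : YoungDiagram) (i : ℕ) :
    (Finset.univ.filter fun c : μ.cells => c.1.1 = i).card = μ.rowLen i := by
  rw [YoungDiagram.rowLen_eq_card, YoungDiagram.row]
  refine Finset.card_bij (fun c _ => c.1) ?_ ?_ ?_
  · intro c hc
    exact Finset.mem_filter.2 ⟨c.2, (Finset.mem_filter.1 hc).2⟩
  · intro c _ d _ h
    exact Subtype.ext h
  · intro c hc
    exact ⟨⟨c, (Finset.mem_filter.1 hc).1⟩, by simpa using (Finset.mem_filter.1 hc).2, rfl⟩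

theorem row_le {T : μ.cells → Fin n} (hT : IsSemistandard T) :
    ∀ (i j : ℕ) (h : (i, j) ∈ μ.cells), i ≤ (T ⟨(i, j), h⟩).val := by
  intro i
  induction i with
  | zero => intros; exact Nat.zero_le _
  | succ i ih =>
    intro j h
    have hm : (i, j) ∈ μ.cells :=
      μ.isLowerSet (show (i, j) ≤ (i + 1, j) from ⟨Nat.le_succ i, le_rfl⟩) h
    have h1 := ih j hm
    have h2 : (T ⟨_, hm⟩).val < (T ⟨_, h⟩).val := hT.2 ⟨_, hm⟩ ⟨_, h⟩ rfl (Nat.lt_succ_self i)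
    omega

theorem content_le {T : μ.cells → Fin n} (hT : IsSemistandard T) (v : Fin n)
    (hv : ∀ u < v, ∀ c : μ.cells, T c = u ↔ c.1.1 = u) :
    content T v ≤ weight n μ v ∧
      (content T v = weight n μ v → ∀ c : μ.cells, T c = v ↔ c.1.1 = v) := by
  have hsub : (Finset.univ.filter fun c => T c = v) ⊆
      Finset.univ.filter fun c : μ.cells => c.1.1 = v := by
    intro c hc
    simp only [Finset.mem_filter, Finset.mem_univ, true_and] at hc ⊢
    have h1 := row_le hT c.1.1 c.1.2 c.2
    rcases h1.lt_or_eq with h | h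
    · exfalso
      have h2 := (hv ⟨c.1.1, by omega⟩ (by rw [← hc]; exact h) c).2 rfl
      rw [Fin.ext_iff] at h2
      simp only at h2
      have h3 : (T ⟨(c.1.1, c.1.2), c.2⟩) = T c := rfl
      rw [h3] at h
      omega
    · rw [h, ← hc]
  have hcard := Finset.card_le_card hsub
  rw [content_apply]
  have hw : weight n μ v = (Finset.univ.filter fun c : μ.cells => c.1.1 = v).card := by
    rw [card_row]; rfl
  rw [hw]
  refine ⟨hcard, fun he c => ?_⟩
  have := Finset.eq_of_subset_of_card_le hsub he.ge
  simpa using Finset.ext_iff.1 this c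

theorem content_eq_weight {T : μ.cells → Fin n} (hT : IsSemistandard T)
    (h : content T = weight n μ) (c : μ.cells) : (T c).val = c.1.1 := by
  have key : ∀ v : Fin n, ∀ c : μ.cells, T c = v ↔ c.1.1 = v := by
    intro v
    induction v using WellFoundedLT.induction with
    | ind v ih => exact (content_le hT v ih).2 (by rw [h])
  exact ((key (T c) c).1 rfl).symm

theorem content_lex_le {T : μ.cells → Fin n} (hT : IsSemistandard T) :
    toLex (content T) ≤ toLex (weight n μ) := by
  by_contra! hlt
  obtain ⟨v, hv, hlt⟩ := hlt
  simp only [ofLex_toLex] at hv hlt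
  have key : ∀ u : Fin n, u < v → ∀ c : μ.cells, T c = u ↔ c.1.1 = u := by
    intro u
    induction u using WellFoundedLT.induction with
    | ind u ih =>
      intro hu
      exact (content_le hT u fun w hw => ih w hw (hw.trans hu)).2 (hv u hu).symm
  exact absurd (content_le hT v key).1 (not_le.2 hlt)

open Classical in
theorem coeff_schurPoly (α : Fin n →₀ ℕ) : coeff α (schurPoly n μ) =
    ((Finset.univ.filter fun T : μ.cells → Fin n => IsSemistandard T).filter
      fun T => content T = α).card := by
  simp only [schurPoly, prod_X_eq, coeff_sum, coeff_monomial]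
  rw [Finset.sum_boole]

theorem coeff_schurPoly_of_lt {α : Fin n →₀ ℕ} (h : toLex (weight n μ) < toLex α) :
    coeff α (schurPoly n μ) = 0 := by
  classical
  rw [coeff_schurPoly, Nat.cast_eq_zero, Finset.card_eq_zero, Finset.filter_eq_empty_iff]
  intro T hT hc
  rw [← hc] at h
  exact absurd (content_lex_le (Finset.mem_filter.1 hT).2) (not_le.2 h)

theorem row_lt (hμ : μ.colLen 0 ≤ n) (c : μ.cells) : c.1.1 < n := by
  have h0 : (c.1.1, 0) ∈ μ :=
    μ.isLowerSet (show (c.1.1, 0) ≤ c.1 from ⟨le_rfl, Nat.zero_le _⟩) c.2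
  rw [YoungDiagram.mem_iff_lt_colLen] at h0
  omega

theorem coeff_weight_schurPoly (hμ : μ.colLen 0 ≤ n) :
    coeff (weight n μ) (schurPoly n μ) = 1 := by
  classical
  rw [coeff_schurPoly, Nat.cast_eq_one, Finset.card_eq_one]
  refine ⟨fun c => ⟨c.1.1, row_lt hμ c⟩, ?_⟩
  ext T
  simp only [Finset.mem_filter, Finset.mem_univ, true_and, Finset.mem_singleton]
  constructor
  · rintro ⟨hT, hc⟩
    funext c
    exact Fin.ext (content_eq_weight hT hc c)
  · rintro rfl
    refine ⟨⟨fun c d h _ => Fin.le_def.2 h.le, fun c d _ h => Fin.lt_def.2 h⟩, ?_⟩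
    ext v
    rw [content_apply, weight, Finsupp.equivFunOnFinite_symm_apply_apply, ← card_row]
    congr 1
    ext c
    simp [Fin.ext_iff]

theorem weight_injective {ν : YoungDiagram} (hμ : μ.colLen 0 ≤ n) (hν : ν.colLen 0 ≤ n)
    (h : weight n μ = weight n ν) : μ = ν := by
  have aux : ∀ κ : YoungDiagram, κ.colLen 0 ≤ n → ∀ c : ℕ × ℕ,
      c ∈ κ ↔ ∃ hc : c.1 < n, c.2 < weight n κ ⟨c.1, hc⟩ := by
    rintro κ hκ ⟨i, j⟩
    constructor
    · intro hc
      exact ⟨row_lt hκ ⟨(i, j), hc⟩, YoungDiagram.mem_iff_lt_rowLen.1 hc⟩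
    · rintro ⟨_, hc⟩
      exact YoungDiagram.mem_iff_lt_rowLen.2 hc
  ext c
  rw [YoungDiagram.mem_cells, YoungDiagram.mem_cells, aux μ hμ, aux ν hν, h]

theorem exists_weight_eq {α : Fin n →₀ ℕ} (hα : Antitone α) :
    ∃ μ : YoungDiagram, μ.colLen 0 ≤ n ∧ weight n μ = α := by
  have hs : (List.ofFn α).SortedGE := List.sortedGE_ofFn_iff.2 hα
  refine ⟨YoungDiagram.ofRowLens (List.ofFn α) hs, ?_, ?_⟩
  · by_contra! hlt
    have := YoungDiagram.mem_iff_lt_colLen.2 hlt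
    rw [YoungDiagram.mem_ofRowLens] at this
    obtain ⟨h, -⟩ := this
    simp at h
  · ext i
    have := YoungDiagram.rowLen_ofRowLens (hw := hs) ⟨i.val, by simp⟩
    simpa [weight] using this

theorem antitone_of_maximal {f : MvPolynomial (Fin n) ℂ} (hf : f.IsSymmetric) {α : Fin n →₀ ℕ}
    (hα : coeff α f ≠ 0) (hmax : ∀ β, coeff β f ≠ 0 → toLex β ≤ toLex α) : Antitone α := by
  intro i j hij
  by_contra! hlt
  have hne : i ≠ j := fun h => by subst h; exact lt_irrefl _ hlt
  have h1 : coeff (α.mapDomain (Equiv.swap i j)) f = coeff α f := by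
    conv_lhs => rw [← hf (Equiv.swap i j)]
    exact coeff_rename_mapDomain _ (Equiv.injective _) _ _
  have h2 := hmax _ (by rw [h1]; exact hα)
  refine absurd h2 (not_le.2 ⟨i, fun k hk => ?_, ?_⟩)
  · simp only [ofLex_toLex]
    rw [Finsupp.mapDomain_equiv_apply, Equiv.symm_swap,
      Equiv.swap_apply_of_ne_of_ne hk.ne (hk.trans_le hij).ne]
  · simp only [ofLex_toLex]
    rw [Finsupp.mapDomain_equiv_apply, Equiv.symm_swap, Equiv.swap_apply_left]
    exact hlt

/-- Schur polynomials in `n` variables, indexed by partitions with at most `n` parts. -/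
noncomputable def schurSymm (n : ℕ) (μ : {μ : YoungDiagram // μ.colLen 0 ≤ n}) :
    symmetricSubalgebra (Fin n) ℂ :=
  ⟨schurPoly n μ.1, schurPoly_isSymmetric n μ.1⟩

theorem linearIndependent_schurSymm (n : ℕ) : LinearIndependent ℂ (schurSymm n) := by
  classical
  rw [linearIndependent_iff']
  intro s g hg
  by_contra! hne
  obtain ⟨ν, hνs, hν⟩ := hne
  obtain ⟨μ, hμ, hmax⟩ := Finset.exists_max_image (s.filter fun κ => g κ ≠ 0)
    (fun κ => toLex (weight n κ.1)) ⟨ν, Finset.mem_filter.2 ⟨hνs, hν⟩⟩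
  rw [Finset.mem_filter] at hμ
  have h0 := congrArg (fun p : symmetricSubalgebra (Fin n) ℂ =>
    coeff (weight n μ.1) (p : MvPolynomial (Fin n) ℂ)) hg
  simp only [AddSubmonoidClass.coe_finsetSum, coeff_sum, ZeroMemClass.coe_zero, coeff_zero] at h0
  rw [Finset.sum_eq_single μ] at h0
  · change coeff _ (g μ • schurPoly n μ.1) = 0 at h0
    rw [coeff_smul, coeff_weight_schurPoly μ.2, smul_eq_mul, mul_one] at h0
    exact hμ.2 h0
  · intro κ hκ hne
    change coeff _ (g κ • schurPoly n κ.1) = 0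
    rw [coeff_smul]
    by_cases hgκ : g κ = 0
    · rw [hgκ, zero_smul]
    · rw [coeff_schurPoly_of_lt, smul_zero]
      refine lt_of_le_of_ne (hmax κ (Finset.mem_filter.2 ⟨hκ, hgκ⟩)) fun h => hne ?_
      exact Subtype.ext (weight_injective κ.2 μ.2 (toLex.injective h))
  · exact fun h => absurd hμ.1 h

theorem mem_span_schurSymm (n : ℕ) : ∀ (d : Lex (Fin n →₀ ℕ)) (f : symmetricSubalgebra (Fin n) ℂ),
    (∀ β, coeff β (f : MvPolynomial (Fin n) ℂ) ≠ 0 → toLex β ≤ d) →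
    f ∈ Submodule.span ℂ (Set.range (schurSymm n)) := by
  intro d
  induction d using WellFoundedLT.induction with
  | ind d ih =>
    intro f hd
    by_cases hf : f = 0
    · rw [hf]; exact Submodule.zero_mem _
    have hsupp : (f : MvPolynomial (Fin n) ℂ).support.Nonempty := by
      rw [Finset.nonempty_iff_ne_empty, Ne, MvPolynomial.support_eq_empty]
      exact fun h => hf (Subtype.ext h)
    obtain ⟨α, hα, hmax⟩ := Finset.exists_max_image _ (fun β => toLex β) hsupp
    have hα' := mem_support_iff.1 hα
    have hmax' : ∀ β, coeff β (f : MvPolynomial (Fin n) ℂ) ≠ 0 → toLex β ≤ toLex α :=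
      fun β hβ => hmax β (mem_support_iff.2 hβ)
    obtain ⟨μ, hμ, rfl⟩ := exists_weight_eq (antitone_of_maximal f.2 hα' hmax')
    set g := f - coeff (weight n μ) (f : MvPolynomial (Fin n) ℂ) • schurSymm n ⟨μ, hμ⟩ with hg
    have hgc : ∀ β, coeff β (g : MvPolynomial (Fin n) ℂ) = coeff β (f : MvPolynomial (Fin n) ℂ) -
        coeff (weight n μ) (f : MvPolynomial (Fin n) ℂ) * coeff β (schurPoly n μ) := by
      intro β
      change coeff β ((f : MvPolynomial (Fin n) ℂ) - _ • schurPoly n μ) = _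
      rw [coeff_sub, coeff_smul, smul_eq_mul]
    have hgmem : g ∈ Submodule.span ℂ (Set.range (schurSymm n)) := by
      by_cases hg0 : g = 0
      · rw [hg0]; exact Submodule.zero_mem _
      have hgs : (g : MvPolynomial (Fin n) ℂ).support.Nonempty := by
        rw [Finset.nonempty_iff_ne_empty, Ne, MvPolynomial.support_eq_empty]
        exact fun h => hg0 (Subtype.ext h)
      obtain ⟨γ, hγ, hγmax⟩ := Finset.exists_max_image _ (fun β => toLex β) hgs
      refine ih (toLex γ) ?_ g fun β hβ => hγmax β (mem_support_iff.2 hβ)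
      refine lt_of_lt_of_le ?_ (hd _ hα')
      have hγ' := mem_support_iff.1 hγ
      rw [hgc] at hγ'
      by_contra! hle
      rcases hle.lt_or_eq with h | h
      · apply hγ'
        rw [coeff_schurPoly_of_lt h, mul_zero, sub_zero]
        by_contra hne
        exact absurd (hmax' γ hne) (not_le.2 h)
      · apply hγ'
        rw [← toLex.injective h, coeff_weight_schurPoly hμ, mul_one, sub_self]
    have : f = g + coeff (weight n μ) (f : MvPolynomial (Fin n) ℂ) • schurSymm n ⟨μ, hμ⟩ := by
      rw [hg]; abel
    rw [this]
    exact Submodule.add_mem _ hgmem (Submodule.smul_mem _ _ (Submodule.subset_span ⟨_, rfl⟩))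

/-- The Schur polynomials `S_μ(x₁, …, xₙ)`, with `μ` running over the partitions with at most `n`
parts, form a basis of the symmetric polynomials in `n` variables. -/
noncomputable def schurBasis (n : ℕ) :
    Module.Basis {μ : YoungDiagram // μ.colLen 0 ≤ n} ℂ (symmetricSubalgebra (Fin n) ℂ) :=
  Module.Basis.mk (linearIndependent_schurSymm n) fun f _ => by
    classical
    by_cases hf : (f : MvPolynomial (Fin n) ℂ).support.Nonempty
    · obtain ⟨α, -, hmax⟩ := Finset.exists_max_image _ (fun β => toLex β) hf
      exact mem_span_schurSymm n (toLex α) f fun β hβ => hmax β (mem_support_iff.2 hβ)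
    · refine mem_span_schurSymm n 0 f fun β hβ => absurd ⟨β, mem_support_iff.2 hβ⟩ hf

theorem schurBasis_apply (n : ℕ) (μ : {μ : YoungDiagram // μ.colLen 0 ≤ n}) :
    (schurBasis n μ : MvPolynomial (Fin n) ℂ) = schurPoly n μ.1 := by
  simp [schurBasis, schurSymm]

end Basis

/-! ### Hook Schur polynomials and the map `ϝ` -/

/-- `(k, ℓ)`-semistandard fillings of a Young diagram.  The alphabet is
`1 < ⋯ < k < 1' < ⋯ < ℓ'`, the lexicographic sum of `k` unprimed and `ℓ` primed symbols. -/
def IsHookSemistandard {k l : ℕ} {μ : YoungDiagram} (T : μ.cells → Fin k ⊕ₗ Fin l) : Prop :=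
  (∀ c d : μ.cells, c.1.1 = d.1.1 → c.1.2 ≤ d.1.2 → T c ≤ T d) ∧
  (∀ c d : μ.cells, c.1.2 = d.1.2 → c.1.1 ≤ d.1.1 → T c ≤ T d) ∧
  (∀ c d : μ.cells, c.1.2 = d.1.2 → T c = T d → (∃ a, T c = Sum.inlₗ a) → c = d) ∧
  (∀ c d : μ.cells, c.1.1 = d.1.1 → T c = T d → (∃ b, T c = Sum.inrₗ b) → c = d)

open Classical in
/-- The hook Schur polynomial `HS_μ(y₁, …, y_k; z₁, …, z_ℓ)`.  The variable `y_j` is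
`X (Sum.inl j)` and `z_j` is `X (Sum.inr j)`. -/
noncomputable def hookSchur (k l : ℕ) (μ : YoungDiagram) : MvPolynomial (Fin k ⊕ Fin l) ℂ :=
  ∑ T : μ.cells → Fin k ⊕ₗ Fin l with IsHookSemistandard T, ∏ c, X (ofLex (T c))

/-- The linear map `ϝ`: if `f = ∑ m_μ S_μ(x₁, …, xₙ)`, the sum being over partitions with at most
`n` parts, then `ϝ f (y; z) = ∑ m_μ HS_μ(y₁, …, y_k; z₁, …, z_ℓ)`. -/
noncomputable def digamma (n k l : ℕ) :
    symmetricSubalgebra (Fin n) ℂ →ₗ[ℂ] MvPolynomial (Fin k ⊕ Fin l) ℂ :=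
  (schurBasis n).constr ℂ fun μ => hookSchur k l μ.1

/-- The bilinear inner product on symmetric polynomials in `n` variables for which the Schur
polynomials are orthonormal. -/
noncomputable def schurInner (n : ℕ) :
    symmetricSubalgebra (Fin n) ℂ →ₗ[ℂ] symmetricSubalgebra (Fin n) ℂ →ₗ[ℂ] ℂ :=
  (schurBasis n).constr ℂ fun μ => (schurBasis n).coord μ

/-! ### The kernel -/

section Kernel

variable (n k l : ℕ)

/-- The kernel `∏ (1 + x_i z_j) ∏ (1 - x_i y_j)⁻¹`, as a formal power series in the `y_j`
and `z_j` with coefficients in `ℂ[x₁, …, xₙ]`. -/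
noncomputable def kernel : MvPowerSeries (Fin k ⊕ Fin l) (MvPolynomial (Fin n) ℂ) :=
  (∏ i : Fin n, ∏ j : Fin l, (1 + MvPowerSeries.C (X i) * MvPowerSeries.X (Sum.inr j))) *
    ∏ i : Fin n, ∏ j : Fin k,
      MvPowerSeries.invOfUnit (1 - MvPowerSeries.C (X i) * MvPowerSeries.X (Sum.inl j)) 1

theorem mul_invOfUnit_linear {σ R : Type*} [CommRing R] (r : R) (s : σ) :
    (1 - MvPowerSeries.C r * MvPowerSeries.X s) *
      MvPowerSeries.invOfUnit (1 - MvPowerSeries.C r * MvPowerSeries.X s) 1 = 1 :=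
  MvPowerSeries.mul_invOfUnit _ _ (by simp)

theorem map_invOfUnit_linear {σ R : Type*} [CommRing R] (φ : R →+* R) (r : R) (s : σ) :
    MvPowerSeries.map φ
        (MvPowerSeries.invOfUnit (1 - MvPowerSeries.C r * MvPowerSeries.X s) 1) =
      MvPowerSeries.invOfUnit (1 - MvPowerSeries.C (φ r) * MvPowerSeries.X s) 1 := by
  have h1 := congrArg (MvPowerSeries.map φ) (mul_invOfUnit_linear r s)
  simp only [map_mul, map_sub, map_one, MvPowerSeries.map_C, MvPowerSeries.map_X] at h1
  have h2 := mul_invOfUnit_linear (φ r) s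
  exact (left_inv_eq_right_inv ((mul_comm _ _).trans h1) h2)

theorem map_kernel (e : Equiv.Perm (Fin n)) :
    MvPowerSeries.map (rename e : MvPolynomial (Fin n) ℂ →ₐ[ℂ] _).toRingHom (kernel n k l) =
      kernel n k l := by
  have hX : ∀ i, (rename e : MvPolynomial (Fin n) ℂ →ₐ[ℂ] _).toRingHom (X i) = X (e i) :=
    fun i => rename_X e i
  generalize (rename e : MvPolynomial (Fin n) ℂ →ₐ[ℂ] _).toRingHom = φ at hX
  rw [kernel, map_mul, map_prod, map_prod]
  congr 1
  · conv_rhs => rw [← Equiv.prod_comp e]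
    refine Finset.prod_congr rfl fun i _ => ?_
    rw [map_prod]
    refine Finset.prod_congr rfl fun j _ => ?_
    rw [map_add, map_one, map_mul, MvPowerSeries.map_C, MvPowerSeries.map_X, hX]
  · conv_rhs => rw [← Equiv.prod_comp e]
    refine Finset.prod_congr rfl fun i _ => ?_
    rw [map_prod]
    refine Finset.prod_congr rfl fun j _ => ?_
    rw [map_invOfUnit_linear, hX]

theorem coeff_kernel_isSymmetric (d : Fin k ⊕ Fin l →₀ ℕ) :
    (MvPowerSeries.coeff d (kernel n k l)).IsSymmetric := by
  intro e
  conv_rhs => rw [← map_kernel n k l e]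
  rw [MvPowerSeries.coeff_map]
  rfl

/-- The coefficient of a monomial in the `y_j` and `z_j` in the kernel, a symmetric polynomial in
`x₁, …, xₙ`. -/
noncomputable def kernelCoeff (d : Fin k ⊕ Fin l →₀ ℕ) : symmetricSubalgebra (Fin n) ℂ :=
  ⟨MvPowerSeries.coeff d (kernel n k l), coeff_kernel_isSymmetric n k l d⟩

/-- The pairing `⟨f, ∏ (1 + x_i z_j) (1 - x_i y_j)⁻¹⟩`, taken coefficientwise in the `y_j` and
`z_j`: a formal power series in these variables. -/
noncomputable def kernelPairing (f : symmetricSubalgebra (Fin n) ℂ) :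
    MvPowerSeries (Fin k ⊕ Fin l) ℂ :=
  fun d => schurInner n f (kernelCoeff n k l d)

end Kernel

/-- The integral `∮_T g dν` over the torus `|x_i| = 1`, where
`dν = (2π√-1)⁻ⁿ (n!)⁻¹ ∏_{i ≠ j} (1 - x_i / x_j) dx₁/x₁ ⋯ dxₙ/xₙ`. -/
noncomputable def weylIntegral (n : ℕ) (g : (Fin n → ℂ) → ℂ) : ℂ :=
  torusIntegral
    (fun x => g x * ((2 * Real.pi * Complex.I) ^ n)⁻¹ * (n.factorial : ℂ)⁻¹ *
      (∏ i, ∏ j with i ≠ j, (1 - x i / x j)) * ∏ i, (x i)⁻¹)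
    0 1

end HookSchur

/-! Everything rests on the one-variable series K(X) = ∏ (1 + z_j X) / ∏ (1 - y_j X) and the
Jacobi–Trudi identity HS_μ = det (K_{μ_i + δ_i - δ_j}), with δ = (n-1, …, 0) and μ of at most n
parts.

That identity (`jacobiTrudi_prod_letterSeries`) is proved by induction on the alphabet. Deleting the
largest letter of a tableau removes a horizontal strip if the letter is unprimed and a vertical
strip if it is primed. On the other side, multiplying the series by 1 / (1 - yX) or 1 + zX expands
the determinant by multilinearity in the rows; the terms that are not strips vanish or cancel in
pairs. For an alphabet of n unprimed letters a matrix factorisation turns the identity into the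
bialternant formula S_μ a_δ = a_{μ+δ} (`schurPoly_mul_alternant`), where a_α = det (x_j^{α_i}).
Hence the S_μ-coordinate of a symmetric g is the coefficient of x^{μ+δ} in a_δ g
(`schurBasis_coord`).

Both formulas are linear in f, so f = S_μ suffices. The kernel is ∏ K(x_i), and the coefficient of
x^{μ+δ} in a_δ ∏ K(x_i) is the Jacobi–Trudi determinant, that is HS_μ. For the integral, the Weyl
density is a_δ(x) a_δ(x⁻¹) / n! and the other factor is ∏ K(x_i⁻¹), which converges absolutely on
the torus because |y_j| < 1. Replacing S_μ a_δ by a_{μ+δ} and using orthogonality of characters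
gives the same determinant once for each of n! permutations. -/

namespace HookSchur

/-! ### Jacobi–Trudi determinants and their strip expansions -/

section JacobiTrudi

variable {R : Type*} [CommRing R] {n : ℕ}

/-- The staircase `(n - 1, n - 2, …, 0)`. -/
def stair (n : ℕ) (i : Fin n) : ℕ := n - 1 - i

theorem stair_strictAnti (n : ℕ) : StrictAnti (stair n) := by
  intro i j h
  have := i.2
  have := j.2
  simp only [stair, Fin.lt_def] at *
  omega

/-- Each step to the right loses at least one. The bound makes the natural subtraction `γ i - stair
n i` exact for strictly decreasing `γ`, so that it inverts the addition of the staircase. -/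
theorem stair_le_of_strictAnti {γ : Fin n → ℕ} (hγ : StrictAnti γ) (i : Fin n) :
    stair n i ≤ γ i := by
  obtain ⟨i, hi⟩ := i
  obtain ⟨d, hd⟩ : ∃ d, d = n - 1 - i := ⟨_, rfl⟩
  induction d generalizing i with
  | zero => simp [stair, ← hd]
  | succ d ih =>
    have h1 := ih (i + 1) (by omega) (by omega)
    have h2 : γ ⟨i + 1, by omega⟩ < γ ⟨i, hi⟩ := hγ (Fin.mk_lt_mk.2 (Nat.lt_succ_self i))
    simp only [stair] at *
    omega

theorem antitone_sub_stair {γ : Fin n → ℕ} (hγ : StrictAnti γ) :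
    Antitone fun i => γ i - stair n i := by
  cases n with
  | zero => exact fun i => i.elim0
  | succ n =>
    refine Fin.antitone_iff_succ_le.2 fun i => ?_
    have h := hγ (Fin.castSucc_lt_succ (i := i))
    have := i.2
    simp only [stair, Fin.val_succ, Fin.val_castSucc]
    omega

/-- The Jacobi–Trudi determinant `det (k_{α_i - δ_j})`, where `δ` is the staircase and `k_r` is the
`r`-th coefficient of `k`. -/
noncomputable def jacobiTrudi (k : PowerSeries R) (α : Fin n → ℕ) : R :=
  (Matrix.of fun i j => PowerSeries.coeff (α i) (PowerSeries.X ^ stair n j * k)).det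

/-- By the Cauchy product, row `i` for `k * e` is a combination of rows for `k` with coefficients
taken from `e`; the determinant is then expanded by multilinearity in the rows. -/
theorem jacobiTrudi_mul (k e : PowerSeries R) (α : Fin n → ℕ) :
    jacobiTrudi (k * e) α = ∑ γ ∈ Fintype.piFinset fun i => Finset.range (α i + 1),
      (∏ i, PowerSeries.coeff (α i - γ i) e) * jacobiTrudi k γ := by
  classical
  have h : (Matrix.of fun i j => PowerSeries.coeff (α i) (PowerSeries.X ^ stair n j * (k * e))) =
      fun i => ∑ g ∈ Finset.range (α i + 1), PowerSeries.coeff (α i - g) e •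
        fun j => PowerSeries.coeff g (PowerSeries.X ^ stair n j * k) := by
    ext i j
    rw [Matrix.of_apply, ← mul_assoc, PowerSeries.coeff_mul,
      Finset.Nat.sum_antidiagonal_eq_sum_range_succ (fun a b =>
        PowerSeries.coeff a (PowerSeries.X ^ stair n j * k) * PowerSeries.coeff b e),
      Finset.sum_apply]
    exact Finset.sum_congr rfl fun g _ => mul_comm _ _
  rw [jacobiTrudi, h]
  refine (MultilinearMap.map_sum_finset Matrix.detRowAlternating.toMultilinearMap _ _).trans
    (Finset.sum_congr rfl fun γ _ => ?_)
  exact MultilinearMap.map_smul_univ Matrix.detRowAlternating.toMultilinearMap _ _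

theorem jacobiTrudi_eq_zero (k : PowerSeries R) {α : Fin n → ℕ} {i j : Fin n} (hij : i ≠ j)
    (h : α i = α j) : jacobiTrudi k α = 0 :=
  Matrix.det_zero_of_row_eq hij (by ext; simp [h])

theorem jacobiTrudi_perm (k : PowerSeries R) (α : Fin n → ℕ) (σ : Equiv.Perm (Fin n)) :
    jacobiTrudi k (α ∘ σ) = Equiv.Perm.sign σ * jacobiTrudi k α := by
  rw [jacobiTrudi, jacobiTrudi, ← Matrix.det_permute]
  rfl

/-- The case of the empty alphabet. For i < j one has δ_j < δ_i ≤ μ_i + δ_i, so the matrix is lower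
triangular, and its diagonal entries test whether μ_i = 0. -/
theorem jacobiTrudi_one (μ : Fin n → ℕ) :
    jacobiTrudi (1 : PowerSeries R) (μ + stair n) = if μ = 0 then 1 else 0 := by
  rw [jacobiTrudi, Matrix.det_of_isLowerTriangular]
  · simp only [mul_one, Matrix.of_apply, PowerSeries.coeff_X_pow, Pi.add_apply, add_eq_right]
    split_ifs with h
    · simp [h]
    · obtain ⟨i, hi⟩ := Function.ne_iff.1 h
      exact Finset.prod_eq_zero (Finset.mem_univ i) (if_neg hi)
  · intro i j hij
    have := stair_strictAnti n (show i < j from hij)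
    rw [Matrix.of_apply, mul_one, PowerSeries.coeff_X_pow, if_neg]
    simp only [Pi.add_apply]
    omega

theorem add_stair_strictAnti {μ : Fin n → ℕ} (hμ : Antitone μ) : StrictAnti (μ + stair n) :=
  hμ.add_strictAnti (stair_strictAnti n)

/-- The weight depends on `γ` only through its sum. It is therefore unchanged when entries of `γ`
are swapped, and for shapes the exponent counts the removed cells. -/
theorem prod_pow_sub_eq (y : R) {α γ : Fin n → ℕ} (h : ∀ i, γ i ≤ α i) :
    ∏ i, y ^ (α i - γ i) = y ^ (∑ i, α i - ∑ i, γ i) := by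
  rw [Finset.prod_pow_eq_pow_sum, Finset.sum_tsub_distrib _ fun i _ => h i]

open Classical in
/-- Multiplication by `1 + zX` adds vertical strips. -/
theorem jacobiTrudi_mul_one_add (k : PowerSeries R) (z : R) {μ : Fin n → ℕ} (hμ : Antitone μ) :
    jacobiTrudi (k * (1 + PowerSeries.C z * PowerSeries.X)) (μ + stair n) =
      ∑ κ ∈ Fintype.piFinset fun i => Finset.range (μ i + 1) with
        Antitone κ ∧ ∀ i, μ i ≤ κ i + 1, (∏ i, z ^ (μ i - κ i)) * jacobiTrudi k (κ + stair n) := by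
  rw [jacobiTrudi_mul]
  have hc : ∀ r, PowerSeries.coeff r (1 + PowerSeries.C z * PowerSeries.X) =
      if r ≤ 1 then z ^ r else 0 := by
    rintro (_ | _ | r)
    · simp
    · simp [PowerSeries.coeff_one]
    · simp [PowerSeries.coeff_one, PowerSeries.coeff_succ_mul_X]
  simp only [hc]
  symm
  refine Finset.sum_of_injOn (· + stair n) (fun a _ b _ h => add_right_cancel h) ?_ ?_ ?_
  · intro κ hκ
    simp only [Finset.coe_filter, Set.mem_ofPred_eq, Fintype.mem_piFinset, Finset.mem_range,
      Finset.mem_coe, Pi.add_apply] at hκ ⊢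
    intro i
    have := hκ.1 i
    omega
  · intro γ hγ hne
    simp only [Fintype.mem_piFinset, Finset.mem_range, Pi.add_apply] at hγ hne ⊢
    -- Lowering entries of the strictly decreasing μ + δ by at most one leaves a weakly decreasing
    -- sequence. A repeated entry gives two equal rows; otherwise γ = κ + δ with κ a partition.
    -- Larger drops meet a zero coefficient of 1 + zX.
    by_cases hs : ∀ i, μ i + stair n i - γ i ≤ 1
    · have hanti : Antitone γ := by
        intro i j hij
        rcases hij.eq_or_lt with rfl | hlt
        · exact le_rfl
        · have h1 := add_stair_strictAnti hμ hlt
          have h2 := hs i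
          have h3 := hγ j
          simp only [Pi.add_apply] at h1
          omega
      by_cases hinj : Function.Injective γ
      · exfalso
        have hst : StrictAnti γ := hanti.strictAnti_of_injective hinj
        have hle := stair_le_of_strictAnti hst
        refine hne ⟨fun i => γ i - stair n i, ?_, ?_⟩
        · simp only [Finset.coe_filter, Set.mem_ofPred_eq, Fintype.mem_piFinset, Finset.mem_range]
          refine ⟨fun i => ?_, antitone_sub_stair hst, fun i => ?_⟩
          · have := hγ i
            omega
          · have := hs i
            omega
        · funext i
          have := hle i
          simp only [Pi.add_apply]
          omega
      · simp only [Function.Injective, not_forall] at hinj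
        obtain ⟨i, j, h1, h2⟩ := hinj
        rw [jacobiTrudi_eq_zero k h2 h1, mul_zero]
    · push Not at hs
      obtain ⟨i, hi⟩ := hs
      rw [Finset.prod_eq_zero (Finset.mem_univ i) (if_neg (by omega)), zero_mul]
  · intro κ hκ
    simp only [Finset.mem_filter] at hκ
    congr 1
    refine Finset.prod_congr rfl fun i _ => ?_
    have := hκ.2.2 i
    simp only [Pi.add_apply, Nat.add_sub_add_right]
    rw [if_pos (by omega)]

open Classical in
/-- The terms that do not interlace cancel in pairs. -/
theorem sum_not_interlacing (k : PowerSeries R) (y : R) {α : Fin n → ℕ} (hα : Antitone α) :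
    ∑ γ ∈ Fintype.piFinset fun i => Finset.range (α i + 1) with
      ∃ i, ∃ h : i + 1 < n, γ ⟨i, by omega⟩ ≤ α ⟨i + 1, h⟩,
        (∏ i, y ^ (α i - γ i)) * jacobiTrudi k γ = 0 := by
  set Bad : (Fin n → ℕ) → ℕ → Prop :=
    fun γ i => ∃ h : i + 1 < n, γ ⟨i, by omega⟩ ≤ α ⟨i + 1, h⟩ with hBad
  have hlt : ∀ γ (h : ∃ i, Bad γ i), Nat.find h + 1 < n := fun γ h => (Nat.find_spec h).1
  -- The sign-reversing involution swaps γ_m and γ_{m+1} at the first bad index m. The bounds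
  -- survive: γ_{m+1} ≤ α_{m+1} ≤ α_m, and γ_m ≤ α_{m+1} is exactly badness.
  set sw : ∀ γ (_ : ∃ i, Bad γ i), Equiv.Perm (Fin n) := fun γ h =>
    Equiv.swap ⟨Nat.find h, by have := hlt γ h; omega⟩ ⟨Nat.find h + 1, hlt γ h⟩ with hsw
  have hle : ∀ γ (h : ∃ i, Bad γ i), (∀ i, γ i ≤ α i) → ∀ i, (γ ∘ sw γ h) i ≤ α i := by
    intro γ h hγ i
    obtain ⟨h1, h2⟩ := Nat.find_spec h
    simp only [hsw, Function.comp_apply, Equiv.swap_apply_def]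
    split_ifs with e1 e2
    · rw [e1]
      exact (hγ _).trans (hα (Fin.mk_le_mk.2 (Nat.le_succ _)))
    · rw [e2]
      exact h2
    · exact hγ i
  -- Badness at an index involves only the entry there. Earlier entries do not move, and the new
  -- entry at m is γ_{m+1} ≤ α_{m+1}; so the first bad index is preserved, and the swap is an
  -- involution.
  have hbad : ∀ γ (h : ∃ i, Bad γ i), (∀ i, γ i ≤ α i) → ∀ m ≤ Nat.find h,
      (Bad (γ ∘ sw γ h) m ↔ m = Nat.find h) := by
    intro γ h hγ m hm
    constructor
    · rintro ⟨h1, h2⟩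
      by_contra hne
      have hml : m < Nat.find h := lt_of_le_of_ne hm hne
      refine Nat.find_min h hml ⟨h1, ?_⟩
      rwa [Function.comp_apply, Equiv.swap_apply_of_ne_of_ne] at h2
      · simp only [ne_eq, Fin.mk.injEq]; omega
      · simp only [ne_eq, Fin.mk.injEq]; omega
    · intro hm
      subst hm
      refine ⟨hlt γ h, ?_⟩
      rw [Function.comp_apply, Equiv.swap_apply_left]
      exact hγ _
  have hfind : ∀ γ (h : ∃ i, Bad γ i) (hγ : ∀ i, γ i ≤ α i) (h' : ∃ i, Bad (γ ∘ sw γ h) i),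
      Nat.find h' = Nat.find h := by
    intro γ h hγ h'
    rw [Nat.find_eq_iff]
    exact ⟨(hbad γ h hγ _ le_rfl).2 rfl,
      fun m hm hb => hm.ne ((hbad γ h hγ m hm.le).1 hb)⟩
  have hmem : ∀ γ, γ ∈ (Fintype.piFinset fun i => Finset.range (α i + 1)).filter
      (fun γ => ∃ i, Bad γ i) ↔ (∀ i, γ i ≤ α i) ∧ ∃ i, Bad γ i := by
    intro γ
    simp only [Finset.mem_filter, Fintype.mem_piFinset, Finset.mem_range, Nat.lt_succ_iff]
  refine Finset.sum_involution (fun γ hγ => γ ∘ sw γ ((hmem γ).1 hγ).2) ?_ ?_ ?_ ?_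
  · intro γ hγ
    obtain ⟨h1, h2⟩ := (hmem γ).1 hγ
    rw [prod_pow_sub_eq y h1, prod_pow_sub_eq y (hle γ h2 h1), jacobiTrudi_perm, hsw,
      Equiv.Perm.sign_swap (by simp)]
    simp only [Function.comp_apply]
    rw [Equiv.sum_comp (Equiv.swap _ _) γ]
    simp
  -- A fixed point has γ_m = γ_{m+1}, so its term is already zero.
  · intro γ hγ hne heq
    refine hne ?_
    have := congrFun heq ⟨Nat.find ((hmem γ).1 hγ).2, by have := hlt γ ((hmem γ).1 hγ).2; omega⟩
    rw [Function.comp_apply, Equiv.swap_apply_left] at this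
    rw [jacobiTrudi_eq_zero k _ this, mul_zero]
    simp
  · intro γ hγ
    obtain ⟨h1, h2⟩ := (hmem γ).1 hγ
    exact (hmem _).2 ⟨hle γ h2 h1, Nat.find h2, (hbad γ h2 h1 _ le_rfl).2 rfl⟩
  · intro γ hγ
    obtain ⟨h1, h2⟩ := (hmem γ).1 hγ
    have h3 : ∃ i, Bad (γ ∘ sw γ h2) i := ⟨_, (hbad γ h2 h1 _ le_rfl).2 rfl⟩
    have h4 : sw (γ ∘ sw γ h2) h3 = sw γ h2 := by
      have := hfind γ h2 h1 h3
      simp only [hsw] at this ⊢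
      congr 1 <;> simp only [Fin.mk.injEq] <;> omega
    change (γ ∘ sw γ h2) ∘ sw (γ ∘ sw γ h2) h3 = γ
    rw [h4]
    funext i
    simp [hsw]

open Classical in
/-- Multiplication by the geometric series `1 / (1 - yX)` adds horizontal strips. -/
theorem jacobiTrudi_mul_geometric (k : PowerSeries R) (y : R) {μ : Fin n → ℕ} (hμ : Antitone μ) :
    jacobiTrudi (k * PowerSeries.mk (y ^ ·)) (μ + stair n) =
      ∑ κ ∈ Fintype.piFinset fun i => Finset.range (μ i + 1) with
        ∀ i j, i < j → μ j ≤ κ i, (∏ i, y ^ (μ i - κ i)) * jacobiTrudi k (κ + stair n) := by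
  rw [jacobiTrudi_mul]
  simp only [PowerSeries.coeff_mk]
  -- The surviving γ satisfy γ_i > μ_{i+1} + δ_{i+1}. Since δ_i = δ_{i+1} + 1, this is κ_i ≥ μ_{i+1}
  -- for κ = γ - δ: the horizontal strip condition.
  rw [← Finset.sum_filter_add_sum_filter_not _
    (fun γ => ∃ i, ∃ h : i + 1 < n, γ ⟨i, by omega⟩ ≤ (μ + stair n) ⟨i + 1, h⟩),
    sum_not_interlacing k y (add_stair_strictAnti hμ).antitone, zero_add]
  symm
  refine Finset.sum_bij' (fun κ _ => κ + stair n) (fun γ _ i => γ i - stair n i) ?_ ?_ ?_ ?_ ?_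
  · intro κ hκ
    simp only [Finset.mem_filter, Fintype.mem_piFinset, Finset.mem_range, Pi.add_apply, not_exists,
      not_le] at hκ ⊢
    refine ⟨fun i => by have := hκ.1 i; omega, fun i hi => ?_⟩
    have h1 := hκ.2 ⟨i, by omega⟩ ⟨i + 1, hi⟩ (Fin.mk_lt_mk.2 (Nat.lt_succ_self i))
    have h2 := stair_strictAnti n (show (⟨i, by omega⟩ : Fin n) < ⟨i + 1, hi⟩ from
      Fin.mk_lt_mk.2 (Nat.lt_succ_self i))
    omega
  all_goals
    intro γ hγ
  · simp only [Finset.mem_filter, Fintype.mem_piFinset, Finset.mem_range, Pi.add_apply, not_exists,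
      not_le] at hγ ⊢
    refine ⟨fun i => by have := hγ.1 i; omega, fun i j hij => ?_⟩
    rw [Fin.lt_def] at hij
    have h1 := hγ.2 i (by omega)
    have h2 : stair n i = stair n ⟨i + 1, by omega⟩ + 1 := by
      simp only [stair]; omega
    have h3 : μ j ≤ μ ⟨i + 1, by omega⟩ := hμ (Fin.le_def.2 hij)
    simp only [Fin.eta] at h1
    omega
  · funext i
    simp
  -- For i < j, γ_i > (μ + δ)_{i+1} ≥ (μ + δ)_j ≥ γ_j, so γ is strictly decreasing and nothing is
  -- lost in the subtraction.
  · have hst : ∀ i, stair n i ≤ γ i := by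
      refine stair_le_of_strictAnti fun i j hij => ?_
      simp only [Finset.mem_filter, Fintype.mem_piFinset, Finset.mem_range, not_exists,
        not_le] at hγ
      rw [Fin.lt_def] at hij
      have h1 := hγ.2 i (by omega)
      have h2 := hγ.1 j
      have h3 : (μ + stair n) j ≤ (μ + stair n) ⟨i + 1, by omega⟩ :=
        (add_stair_strictAnti hμ).antitone (Fin.le_def.2 hij)
      simp only [Fin.eta] at h1
      omega
    funext i
    have := hst i
    simp only [Pi.add_apply]
    omega
  · simp only [Pi.add_apply, Nat.add_sub_add_right]

end JacobiTrudi

/-! ### Tableaux over an alphabet of primed and unprimed letters -/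

section Tableaux

variable {R : Type*} [CommRing R]

/-- Semistandard fillings of a finite set of cells by a linearly ordered alphabet, some letters of
which are primed: weakly increasing along rows and columns, with unprimed letters not repeated in a
column and primed letters not repeated in a row. -/
def IsTableau {A : Type*} [LE A] (p : A → Prop) {s : Finset (ℕ × ℕ)} (T : s → A) : Prop :=
  (∀ c d : s, c.1.1 = d.1.1 → c.1.2 ≤ d.1.2 → T c ≤ T d) ∧
  (∀ c d : s, c.1.2 = d.1.2 → c.1.1 ≤ d.1.1 → T c ≤ T d) ∧
  (∀ c d : s, c.1.2 = d.1.2 → T c = T d → ¬ p (T c) → c = d) ∧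
  (∀ c d : s, c.1.1 = d.1.1 → T c = T d → p (T c) → c = d)

open Classical in
/-- The weighted generating function of the semistandard fillings of `s`. -/
noncomputable def tableauSum {A : Type*} [LE A] [Fintype A] (p : A → Prop) (w : A → R)
    (s : Finset (ℕ × ℕ)) : R :=
  ∑ T : s → A with IsTableau p T, ∏ c, w (T c)

/-- The condition on a set `t` of cells of `s` under which the largest letter of the alphabet, primed
or not according to `P`, may fill `s \ t`. -/
def IsStripComplement (P : Prop) (s t : Finset (ℕ × ℕ)) : Prop :=
  (∀ c ∈ s, ∀ d ∈ t, c.1 = d.1 → c.2 ≤ d.2 → c ∈ t) ∧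
  (∀ c ∈ s, ∀ d ∈ t, c.2 = d.2 → c.1 ≤ d.1 → c ∈ t) ∧
  (¬ P → ∀ c ∈ s, ∀ d ∈ s, c ∉ t → d ∉ t → c.2 = d.2 → c = d) ∧
  (P → ∀ c ∈ s, ∀ d ∈ s, c ∉ t → d ∉ t → c.1 = d.1 → c = d)

/-- Entries increase weakly, so the cells carrying smaller letters are closed to the left and
upwards within `s`; the remaining cells all carry the same letter and inherit its rule against
repetition. -/
theorem isStripComplement_of_isTableau {m : ℕ} {p : Fin (m + 1) → Prop} {s : Finset (ℕ × ℕ)}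
    {T : s → Fin (m + 1)} (hT : IsTableau p T) {t : Finset (ℕ × ℕ)} (hts : t ⊆ s)
    (ht : ∀ c : s, c.1 ∈ t ↔ T c ≠ Fin.last m) : IsStripComplement (p (Fin.last m)) s t := by
  refine ⟨fun c hc d hd h1 h2 => ?_, fun c hc d hd h1 h2 => ?_,
    fun hP c hc d hd h1 h2 h3 => ?_, fun hP c hc d hd h1 h2 h3 => ?_⟩
  · have h3 := hT.1 ⟨c, hc⟩ ⟨d, hts hd⟩ h1 h2
    have h4 := (ht ⟨d, hts hd⟩).1 hd
    exact (ht ⟨c, hc⟩).2 (h3.trans_lt (Fin.lt_last_iff_ne_last.2 h4)).ne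
  · have h3 := hT.2.1 ⟨c, hc⟩ ⟨d, hts hd⟩ h1 h2
    have h4 := (ht ⟨d, hts hd⟩).1 hd
    exact (ht ⟨c, hc⟩).2 (h3.trans_lt (Fin.lt_last_iff_ne_last.2 h4)).ne
  · have e1 := not_not.1 (mt (ht ⟨c, hc⟩).2 h1)
    have e2 := not_not.1 (mt (ht ⟨d, hd⟩).2 h2)
    exact congrArg Subtype.val (hT.2.2.1 ⟨c, hc⟩ ⟨d, hd⟩ h3 (e1.trans e2.symm) (by rwa [e1]))
  · have e1 := not_not.1 (mt (ht ⟨c, hc⟩).2 h1)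
    have e2 := not_not.1 (mt (ht ⟨d, hd⟩).2 h2)
    exact congrArg Subtype.val (hT.2.2.2 ⟨c, hc⟩ ⟨d, hd⟩ h3 (e1.trans e2.symm) (by rwa [e1]))

open Classical in
/-- Extend a filling of `t` to `s` by the largest letter. -/
noncomputable def extendFilling {m : ℕ} (s : Finset (ℕ × ℕ)) {t : Finset (ℕ × ℕ)} (U : t → Fin m)
    (c : s) : Fin (m + 1) :=
  if h : c.1 ∈ t then (U ⟨c.1, h⟩).castSucc else Fin.last m

theorem extendFilling_of_mem {m : ℕ} {s t : Finset (ℕ × ℕ)} (U : t → Fin m) {c : s}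
    (h : c.1 ∈ t) : extendFilling s U c = (U ⟨c.1, h⟩).castSucc := dif_pos h

theorem extendFilling_of_notMem {m : ℕ} {s t : Finset (ℕ × ℕ)} (U : t → Fin m) {c : s}
    (h : c.1 ∉ t) : extendFilling s U c = Fin.last m := dif_neg h

theorem extendFilling_ne_last_iff {m : ℕ} {s t : Finset (ℕ × ℕ)} (U : t → Fin m) (c : s) :
    extendFilling s U c ≠ Fin.last m ↔ c.1 ∈ t := by
  by_cases h : c.1 ∈ t
  · simp [extendFilling_of_mem U h, h, Fin.castSucc_ne_last]
  · simp [extendFilling_of_notMem U h, h]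

theorem isTableau_extendFilling {m : ℕ} {p : Fin (m + 1) → Prop} {s t : Finset (ℕ × ℕ)}
    (h : IsStripComplement (p (Fin.last m)) s t) {U : t → Fin m}
    (hU : IsTableau (fun a : Fin m => p a.castSucc) U) : IsTableau p (extendFilling s U) := by
  obtain ⟨s1, s2, s3, s4⟩ := h
  obtain ⟨u1, u2, u3, u4⟩ := hU
  refine ⟨fun c d h1 h2 => ?_, fun c d h1 h2 => ?_, fun c d h1 h2 h3 => ?_,
    fun c d h1 h2 h3 => ?_⟩
  · by_cases hd : d.1 ∈ t
    · have hc := s1 _ c.2 _ hd h1 h2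
      rw [extendFilling_of_mem U hc, extendFilling_of_mem U hd, Fin.castSucc_le_castSucc_iff]
      exact u1 _ _ h1 h2
    · rw [extendFilling_of_notMem U hd]
      exact Fin.le_last _
  · by_cases hd : d.1 ∈ t
    · have hc := s2 _ c.2 _ hd h1 h2
      rw [extendFilling_of_mem U hc, extendFilling_of_mem U hd, Fin.castSucc_le_castSucc_iff]
      exact u2 _ _ h1 h2
    · rw [extendFilling_of_notMem U hd]
      exact Fin.le_last _
  all_goals
    -- Equal entries put both cells inside `t`, where the rule for `U` applies, or both outside,
    -- where the strip condition does.
    have hiff : c.1 ∈ t ↔ d.1 ∈ t := by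
      rw [← extendFilling_ne_last_iff U c, h2, extendFilling_ne_last_iff]
    by_cases hc : c.1 ∈ t
    · have hd := hiff.1 hc
      rw [extendFilling_of_mem U hc] at h2 h3
      rw [extendFilling_of_mem U hd] at h2
      have h2' := Fin.castSucc_injective _ h2
      have := by first
        | exact congrArg Subtype.val (u3 ⟨c.1, hc⟩ ⟨d.1, hd⟩ h1 h2' h3)
        | exact congrArg Subtype.val (u4 ⟨c.1, hc⟩ ⟨d.1, hd⟩ h1 h2' h3)
      exact Subtype.ext this
    · have hd := mt hiff.2 hc
      rw [extendFilling_of_notMem U hc] at h3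
      first
        | exact Subtype.ext (s3 h3 _ c.2 _ d.2 hc hd h1)
        | exact Subtype.ext (s4 h3 _ c.2 _ d.2 hc hd h1)

theorem isTableau_restrict {m : ℕ} {p : Fin (m + 1) → Prop} {s t : Finset (ℕ × ℕ)} (hts : t ⊆ s)
    {U : t → Fin m} (h : IsTableau p (extendFilling s U)) :
    IsTableau (fun a : Fin m => p a.castSucc) U := by
  have e : ∀ c : t, extendFilling s U ⟨c.1, hts c.2⟩ = (U c).castSucc := fun c =>
    extendFilling_of_mem U c.2
  obtain ⟨h1, h2, h3, h4⟩ := h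
  refine ⟨fun c d a b => ?_, fun c d a b => ?_, fun c d a b hp => ?_, fun c d a b hp => ?_⟩
  · simpa [e] using h1 ⟨c.1, hts c.2⟩ ⟨d.1, hts d.2⟩ a b
  · simpa [e] using h2 ⟨c.1, hts c.2⟩ ⟨d.1, hts d.2⟩ a b
  · have := h3 ⟨c.1, hts c.2⟩ ⟨d.1, hts d.2⟩ a (by rw [e, e, b]) (by rwa [e])
    exact Subtype.ext (congrArg (fun x : s => x.1) this)
  · have := h4 ⟨c.1, hts c.2⟩ ⟨d.1, hts d.2⟩ a (by rw [e, e, b]) (by rwa [e])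
    exact Subtype.ext (congrArg (fun x : s => x.1) this)

theorem prod_extendFilling {m : ℕ} (w : Fin (m + 1) → R) {s t : Finset (ℕ × ℕ)} (hts : t ⊆ s)
    (U : t → Fin m) :
    ∏ c, w (extendFilling s U c) = w (Fin.last m) ^ (s \ t).card * ∏ c, w (U c).castSucc := by
  classical
  have h1 : ∀ (r : Finset (ℕ × ℕ)) (V : r → Fin (m + 1)), ∏ c, w (V c) =
      ∏ c ∈ r, if h : c ∈ r then w (V ⟨c, h⟩) else 1 := by
    intro r V
    rw [← Finset.prod_coe_sort r]
    exact Finset.prod_congr rfl fun c _ => by simp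
  rw [h1, ← Finset.prod_sdiff hts, h1 t fun c => (U c).castSucc]
  congr 1
  · rw [← Finset.prod_const]
    refine Finset.prod_congr rfl fun c hc => ?_
    rw [Finset.mem_sdiff] at hc
    rw [dif_pos hc.1, extendFilling_of_notMem U hc.2]
  · refine Finset.prod_congr rfl fun c hc => ?_
    rw [dif_pos (hts hc), dif_pos hc, extendFilling_of_mem U hc]

open Classical in
/-- Removing the largest letter. -/
theorem tableauSum_succ {m : ℕ} (p : Fin (m + 1) → Prop) (w : Fin (m + 1) → R)
    (s : Finset (ℕ × ℕ)) : tableauSum p w s =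
      ∑ t ∈ s.powerset with IsStripComplement (p (Fin.last m)) s t,
        w (Fin.last m) ^ (s \ t).card *
          tableauSum (fun a : Fin m => p a.castSucc) (fun a => w a.castSucc) t := by
  have hmem : ∀ (T : s → Fin (m + 1)) (c : s),
      c.1 ∈ (s.attach.filter fun c => T c ≠ Fin.last m).image Subtype.val ↔ T c ≠ Fin.last m := by
    intro T c
    simp only [Finset.mem_image, Finset.mem_filter, Finset.mem_attach, true_and]
    exact ⟨fun ⟨d, hd, h⟩ => Subtype.ext h ▸ hd, fun h => ⟨c, h, rfl⟩⟩
  have hsub : ∀ T : s → Fin (m + 1),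
      (s.attach.filter fun c => T c ≠ Fin.last m).image Subtype.val ⊆ s := by
    intro T c hc
    obtain ⟨d, -, rfl⟩ := Finset.mem_image.1 hc
    exact d.2
  -- Tableaux are grouped by the set of cells not carrying the largest letter. The fibre over `t`
  -- corresponds, through `extendFilling`, to the tableaux on `t` in the remaining letters.
  rw [tableauSum, ← Finset.sum_fiberwise_of_maps_to
    (g := fun T : s → Fin (m + 1) => (s.attach.filter fun c => T c ≠ Fin.last m).image Subtype.val)
    (t := s.powerset.filter (IsStripComplement (p (Fin.last m)) s))]
  · refine Finset.sum_congr rfl fun t ht => ?_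
    rw [Finset.mem_filter, Finset.mem_powerset] at ht
    have hts := ht.1
    rw [tableauSum, Finset.mul_sum]
    symm
    refine Finset.sum_bij (fun U _ => extendFilling s U) ?_ ?_ ?_ ?_
    · intro U hU
      rw [Finset.mem_filter] at hU
      simp only [Finset.mem_filter, Finset.mem_univ, true_and]
      refine ⟨isTableau_extendFilling ht.2 hU.2, ?_⟩
      ext c
      by_cases hc : c ∈ s
      · rw [hmem (extendFilling s U) ⟨c, hc⟩, extendFilling_ne_last_iff]
      · exact ⟨fun h => absurd (hsub _ h) hc, fun h => absurd (hts h) hc⟩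
    · intro U _ V _ h
      funext c
      have := congrFun h ⟨c.1, hts c.2⟩
      rw [extendFilling_of_mem (c := ⟨c.1, hts c.2⟩) U c.2,
        extendFilling_of_mem (c := ⟨c.1, hts c.2⟩) V c.2] at this
      exact Fin.castSucc_injective _ this
    · intro T hT
      simp only [Finset.mem_filter, Finset.mem_univ, true_and] at hT
      obtain ⟨hT, rfl⟩ := hT
      have hne := fun c : ((s.attach.filter fun c => T c ≠ Fin.last m).image Subtype.val : _) =>
        (hmem T ⟨c.1, hts c.2⟩).1 c.2
      have hext : extendFilling s (fun c => (T ⟨c.1, hts c.2⟩).castPred (hne c)) = T := by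
        funext c
        by_cases hc : T c = Fin.last m
        · rw [extendFilling_of_notMem _ (mt (hmem T c).1 (not_not.2 hc)), hc]
        · rw [extendFilling_of_mem _ ((hmem T c).2 hc), Fin.castSucc_castPred]
      refine ⟨_, ?_, hext⟩
      rw [Finset.mem_filter]
      exact ⟨Finset.mem_univ _, isTableau_restrict hts (by rwa [hext])⟩
    · intro U _
      rw [prod_extendFilling w hts]
  · intro T hT
    rw [Finset.mem_filter] at hT
    rw [Finset.mem_filter, Finset.mem_powerset]
    exact ⟨hsub T, isStripComplement_of_isTableau hT.2 (hsub T) (hmem T)⟩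

end Tableaux

/-! ### Shapes of partitions and the Jacobi–Trudi identity -/

section Shape

variable {R : Type*} [CommRing R] {n : ℕ}

/-- The cells `(i, j)` with `j < κ i`. -/
def shape (κ : Fin n → ℕ) : Finset (ℕ × ℕ) :=
  Finset.univ.biUnion fun i => (Finset.range (κ i)).image fun j => (i.val, j)

theorem mem_shape {κ : Fin n → ℕ} {c : ℕ × ℕ} :
    c ∈ shape κ ↔ ∃ h : c.1 < n, c.2 < κ ⟨c.1, h⟩ := by
  obtain ⟨a, b⟩ := c
  simp only [shape, Finset.mem_biUnion, Finset.mem_univ, true_and, Finset.mem_image,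
    Finset.mem_range, Prod.mk.injEq]
  constructor
  · rintro ⟨i, j, hj, rfl, rfl⟩
    exact ⟨i.2, hj⟩
  · rintro ⟨h, hb⟩
    exact ⟨⟨a, h⟩, b, hb, rfl, rfl⟩

theorem mk_mem_shape {κ : Fin n → ℕ} {i : Fin n} {j : ℕ} : (i.val, j) ∈ shape κ ↔ j < κ i := by
  simp [mem_shape]

theorem card_shape (κ : Fin n → ℕ) : (shape κ).card = ∑ i, κ i := by
  rw [shape, Finset.card_biUnion]
  · refine Finset.sum_congr rfl fun i _ => ?_
    rw [Finset.card_image_of_injective _ (Prod.mk_right_injective _), Finset.card_range]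
  · intro i _ j _ hij
    simp only [Function.onFun, Finset.disjoint_left, Finset.mem_image, not_exists, not_and]
    rintro _ ⟨a, -, rfl⟩ b - h
    exact hij (Fin.ext (congrArg Prod.fst h).symm)

theorem shape_injective : Function.Injective (shape : (Fin n → ℕ) → Finset (ℕ × ℕ)) := by
  intro κ ν h
  funext i
  refine eq_of_forall_lt_iff fun j => ?_
  rw [← mk_mem_shape, h, mk_mem_shape]

theorem shape_subset_shape {κ μ : Fin n → ℕ} : shape κ ⊆ shape μ ↔ κ ≤ μ := by
  constructor
  · intro h i
    by_contra! hlt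
    exact lt_irrefl _ (mk_mem_shape.1 (h (mk_mem_shape.2 hlt)))
  · rintro h ⟨a, b⟩ hc
    obtain ⟨ha, hb⟩ := mem_shape.1 hc
    exact mem_shape.2 ⟨ha, hb.trans_le (h _)⟩

/-- Each row of `t` is an initial segment, hence determined by its cardinality. Monotonicity of the
row lengths is not claimed here; it comes from closure along columns. -/
theorem exists_shape_eq {μ : Fin n → ℕ} {t : Finset (ℕ × ℕ)} (hts : t ⊆ shape μ)
    (h : ∀ c ∈ shape μ, ∀ d ∈ t, c.1 = d.1 → c.2 ≤ d.2 → c ∈ t) : ∃ κ : Fin n → ℕ, shape κ = t := by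
  refine ⟨fun i => ((t.filter fun c => c.1 = i.val).image Prod.snd).card, ?_⟩
  have hrow : ∀ (i : Fin n) (j : ℕ), j ∈ (t.filter fun c => c.1 = i.val).image Prod.snd ↔
      (i.val, j) ∈ t := by
    intro i j
    simp only [Finset.mem_image, Finset.mem_filter]
    exact ⟨by rintro ⟨⟨a, b⟩, ⟨h1, rfl⟩, rfl⟩; exact h1, fun hm => ⟨_, ⟨hm, rfl⟩, rfl⟩⟩
  ext ⟨a, b⟩
  rw [mem_shape]
  constructor
  · rintro ⟨ha, hb⟩
    rw [← mem_iff_lt_card_of_isLowerSet, hrow] at hb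
    · exact hb
    · intro x hx y hy
      rw [hrow] at hx ⊢
      exact h _ (mk_mem_shape.2 (hy.trans_lt (mk_mem_shape.1 (hts hx)))) _ hx rfl hy
  · intro hc
    obtain ⟨ha, -⟩ := mem_shape.1 (hts hc)
    refine ⟨ha, ?_⟩
    rw [← mem_iff_lt_card_of_isLowerSet, hrow]
    · exact hc
    · intro x hx y hy
      rw [hrow] at hx ⊢
      exact h _ (mk_mem_shape.2 (hy.trans_lt (mk_mem_shape.1 (hts hx)))) _ hx rfl hy

/-- Row i loses the columns κ_i, …, μ_i - 1. Rows i < j lose no common column exactly when μ_j ≤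
κ_i, and a row loses at most one cell exactly when μ_i ≤ κ_i + 1. Violations are detected at column
κ_i, the first one outside row i of κ. -/
theorem isStripComplement_shape_iff {P : Prop} {κ μ : Fin n → ℕ} (hμ : Antitone μ) (hle : κ ≤ μ) :
    IsStripComplement P (shape μ) (shape κ) ↔
      Antitone κ ∧ (¬ P → ∀ i j, i < j → μ j ≤ κ i) ∧ (P → ∀ i, μ i ≤ κ i + 1) := by
  constructor
  · rintro ⟨-, h2, h3, h4⟩
    refine ⟨fun i j hij => ?_, fun hP i j hij => ?_, fun hP i => ?_⟩
    · by_contra! hlt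
      exact lt_irrefl _ (mk_mem_shape.1 (h2 (i.val, κ i)
        (mk_mem_shape.2 (hlt.trans_le ((hle j).trans (hμ hij)))) (j.val, κ i)
        (mk_mem_shape.2 hlt) rfl hij))
    · by_contra! hlt
      have hκ : κ j ≤ κ i := by
        by_contra! hlt
        exact lt_irrefl _ (mk_mem_shape.1 (h2 (i.val, κ i)
          (mk_mem_shape.2 (hlt.trans_le ((hle j).trans (hμ hij.le)))) (j.val, κ i)
          (mk_mem_shape.2 hlt) rfl hij.le))
      have := h3 hP (i.val, κ i) (mk_mem_shape.2 (hlt.trans_le (hμ hij.le))) (j.val, κ i)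
        (mk_mem_shape.2 hlt) (fun h => lt_irrefl _ (mk_mem_shape.1 h))
        (fun h => absurd (mk_mem_shape.1 h) (not_lt.2 hκ)) rfl
      exact hij.ne (Fin.ext (congrArg Prod.fst this))
    · by_contra! hlt
      have := h4 hP (i.val, κ i) (mk_mem_shape.2 (by omega)) (i.val, κ i + 1)
        (mk_mem_shape.2 hlt) (fun h => lt_irrefl _ (mk_mem_shape.1 h))
        (fun h => absurd (mk_mem_shape.1 h) (by omega)) rfl
      exact absurd (congrArg Prod.snd this) (by simp)
  · rintro ⟨h1, h2, h3⟩
    refine ⟨?_, ?_, ?_, ?_⟩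
    · rintro ⟨a, b⟩ hc ⟨a', b'⟩ hd rfl hb
      obtain ⟨ha, hd⟩ := mem_shape.1 hd
      exact mem_shape.2 ⟨ha, lt_of_le_of_lt hb hd⟩
    · rintro ⟨a, b⟩ hc ⟨a', b'⟩ hd rfl ha'
      obtain ⟨ha, hc⟩ := mem_shape.1 hc
      obtain ⟨ha2, hd⟩ := mem_shape.1 hd
      exact mem_shape.2 ⟨ha, hd.trans_le (h1 (Fin.le_def.2 ha'))⟩
    · rintro hP ⟨a, b⟩ hc ⟨a', b'⟩ hd hc' hd' rfl
      obtain ⟨ha, hc⟩ := mem_shape.1 hc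
      obtain ⟨ha2, hd⟩ := mem_shape.1 hd
      rcases lt_trichotomy a a' with hlt | rfl | hlt
      · exact absurd (mem_shape.2 ⟨ha, hd.trans_le (h2 hP ⟨a, ha⟩ ⟨a', ha2⟩ hlt)⟩) hc'
      · rfl
      · exact absurd (mem_shape.2 ⟨ha2, hc.trans_le (h2 hP ⟨a', ha2⟩ ⟨a, ha⟩ hlt)⟩) hd'
    · rintro hP ⟨a, b⟩ hc ⟨a', b'⟩ hd hc' hd' rfl
      obtain ⟨ha, hc⟩ := mem_shape.1 hc
      obtain ⟨ha2, hd⟩ := mem_shape.1 hd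
      simp only [mem_shape, not_exists, not_lt] at hc' hd'
      have e1 := h3 hP ⟨a, ha⟩
      have e2 := hc' ha
      have e3 := hd' ha
      simp only at hc hd
      ext
      · rfl
      · simp only
        omega

open Classical in
-- The recursion on letters in terms of row lengths, with the index set and weights of the two
-- determinant expansions, so that the induction can match them term by term.
theorem tableauSum_shape_succ {m : ℕ} (p : Fin (m + 1) → Prop) (w : Fin (m + 1) → R)
    {μ : Fin n → ℕ} (hμ : Antitone μ) : tableauSum p w (shape μ) =
      ∑ κ ∈ Fintype.piFinset fun i => Finset.range (μ i + 1) with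
        Antitone κ ∧ (¬ p (Fin.last m) → ∀ i j, i < j → μ j ≤ κ i) ∧
          (p (Fin.last m) → ∀ i, μ i ≤ κ i + 1),
        (∏ i, w (Fin.last m) ^ (μ i - κ i)) *
          tableauSum (fun a : Fin m => p a.castSucc) (fun a => w a.castSucc) (shape κ) := by
  have hpi : ∀ κ : Fin n → ℕ, κ ∈ (Fintype.piFinset fun i => Finset.range (μ i + 1)) ↔ κ ≤ μ := by
    intro κ
    simp only [Fintype.mem_piFinset, Finset.mem_range, Nat.lt_succ_iff]
    rfl
  rw [tableauSum_succ]
  symm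
  refine Finset.sum_bij (fun κ _ => shape κ) ?_ (fun _ _ _ _ h => shape_injective h) ?_ ?_
  · intro κ hκ
    rw [Finset.mem_filter, hpi] at hκ
    rw [Finset.mem_filter, Finset.mem_powerset, shape_subset_shape]
    exact ⟨hκ.1, (isStripComplement_shape_iff hμ hκ.1).2 hκ.2⟩
  · intro t ht
    rw [Finset.mem_filter, Finset.mem_powerset] at ht
    obtain ⟨κ, rfl⟩ := exists_shape_eq ht.1 ht.2.1
    have hle := shape_subset_shape.1 ht.1
    refine ⟨κ, ?_, rfl⟩
    rw [Finset.mem_filter, hpi]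
    exact ⟨hle, (isStripComplement_shape_iff hμ hle).1 ht.2⟩
  · intro κ hκ
    rw [Finset.mem_filter, hpi] at hκ
    rw [prod_pow_sub_eq _ hκ.1, Finset.card_sdiff_of_subset (shape_subset_shape.2 hκ.1), card_shape,
      card_shape]

open Classical in
/-- The power series attached to a letter: `1 + wX` if it is primed, `1 / (1 - wX)` otherwise. -/
noncomputable def letterSeries (P : Prop) (w : R) : PowerSeries R :=
  if P then 1 + PowerSeries.C w * PowerSeries.X else PowerSeries.mk (w ^ ·)

/-- The Jacobi–Trudi formula for generating functions of semistandard fillings. -/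
theorem jacobiTrudi_prod_letterSeries {m : ℕ} (p : Fin m → Prop) (w : Fin m → R) {μ : Fin n → ℕ}
    (hμ : Antitone μ) :
    jacobiTrudi (∏ a, letterSeries (p a) (w a)) (μ + stair n) = tableauSum p w (shape μ) := by
  classical
  induction m generalizing μ with
  | zero =>
    rw [Finset.univ_eq_empty, Finset.prod_empty, jacobiTrudi_one]
    split_ifs with h
    · have : shape μ = ∅ := by rw [← Finset.card_eq_zero, card_shape, h]; simp
      have hemp : IsEmpty (shape μ) := by rw [this]; infer_instance
      rw [tableauSum, Finset.filter_true_of_mem]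
      · simp
      · exact fun T _ => ⟨fun c => hemp.elim c, fun c => hemp.elim c, fun c => hemp.elim c,
          fun c => hemp.elim c⟩
    · obtain ⟨i, hi⟩ := Function.ne_iff.1 h
      have hmem : (i.val, 0) ∈ shape μ := mk_mem_shape.2 (Nat.pos_of_ne_zero hi)
      have : IsEmpty (shape μ → Fin 0) := ⟨fun T => (T ⟨_, hmem⟩).elim0⟩
      rw [tableauSum, Finset.univ_eq_empty, Finset.filter_empty, Finset.sum_empty]
  | succ m ih =>
    rw [Fin.prod_univ_castSucc, tableauSum_shape_succ p w hμ]
    by_cases hp : p (Fin.last m)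
    · rw [letterSeries, if_pos hp, jacobiTrudi_mul_one_add _ _ hμ]
      simp only [hp, not_true_eq_false, false_implies, true_and, true_implies]
      refine Finset.sum_congr rfl fun κ hκ => ?_
      rw [Finset.mem_filter] at hκ
      rw [ih _ _ hκ.2.1]
    · rw [letterSeries, if_neg hp, jacobiTrudi_mul_geometric _ _ hμ]
      simp only [hp, not_false_eq_true, false_implies, and_true, true_implies]
      -- For horizontal strips monotonicity is automatic, since κ_j ≤ μ_j ≤ κ_i for i < j; the
      -- determinant expansion does not list it separately.
      have hanti : ∀ κ ∈ Fintype.piFinset fun i => Finset.range (μ i + 1),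
          (∀ i j, i < j → μ j ≤ κ i) → Antitone κ := by
        intro κ hκ h i j hij
        rcases hij.eq_or_lt with rfl | hlt
        · exact le_rfl
        · exact (Nat.lt_succ_iff.1 (Finset.mem_range.1 (Fintype.mem_piFinset.1 hκ j))).trans
            (h i j hlt)
      refine Finset.sum_congr ?_ fun κ hκ => ?_
      · refine Finset.filter_congr fun κ hκ => ?_
        exact ⟨fun h => ⟨hanti κ hκ h, h⟩, fun h => h.2⟩
      · rw [Finset.mem_filter] at hκ
        rw [ih _ _ hκ.2.1]

end Shape

/-! ### Alternants and the bialternant formula -/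

section Alternant

variable {R : Type*} [CommRing R] {n : ℕ}

/-- The alternant `det (y_j ^ α_i)`. -/
noncomputable def alternant (y : Fin n → R) (α : Fin n → ℕ) : R :=
  (Matrix.of fun i j => y j ^ α i).det

theorem alternant_eq_sum (y : Fin n → R) (α : Fin n → ℕ) :
    alternant y α = ∑ σ : Equiv.Perm (Fin n), (Equiv.Perm.sign σ : R) * ∏ i, y i ^ α (σ i) := by
  rw [alternant, Matrix.det_apply']
  rfl

theorem map_alternant {S : Type*} [CommRing S] (φ : R →+* S) (y : Fin n → R) (α : Fin n → ℕ) :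
    φ (alternant y α) = alternant (fun i => φ (y i)) α := by
  simp [alternant_eq_sum]

theorem one_sub_mul_geometric (y : R) :
    (1 - PowerSeries.C y * PowerSeries.X) * PowerSeries.mk (y ^ ·) = 1 := by
  ext r
  cases r with
  | zero => simp [sub_mul]
  | succ r =>
    rw [sub_mul, one_mul, mul_assoc, map_sub, PowerSeries.coeff_C_mul,
      PowerSeries.coeff_succ_X_mul, PowerSeries.coeff_mk, PowerSeries.coeff_mk,
      PowerSeries.coeff_one, if_neg (Nat.succ_ne_zero r), pow_succ', sub_self]

theorem stair_eq_rev (i : Fin n) : stair n i = (Fin.rev i).val := by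
  simp only [stair, Fin.val_rev]
  omega

/-- The matrix (k_{δ_i - δ_j}) is upper unitriangular. This normalises the bialternant formula. -/
theorem jacobiTrudi_stair {k : PowerSeries R} (hk : PowerSeries.constantCoeff k = 1) :
    jacobiTrudi k (stair n) = 1 := by
  rw [jacobiTrudi, Matrix.det_of_isUpperTriangular]
  · refine Finset.prod_eq_one fun i _ => ?_
    rw [Matrix.of_apply, PowerSeries.coeff_X_pow_mul', if_pos le_rfl, Nat.sub_self,
      PowerSeries.coeff_zero_eq_constantCoeff_apply, hk]
  · intro i j hij
    have := stair_strictAnti n (show j < i from hij)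
    rw [Matrix.of_apply, PowerSeries.coeff_X_pow_mul', if_neg (by omega)]

/-- All factors other than the `j`-th cancel. The powers of `y j` thus become coefficients of one
series, common to all `j`, times a polynomial of degree less than `n`, which is what factors the
alternant matrix. -/
theorem geometric_eq_mul (y : Fin n → R) (j : Fin n) :
    PowerSeries.mk (y j ^ ·) = (∏ l, PowerSeries.mk (y l ^ ·)) *
      ((∏ l ∈ Finset.univ.erase j, (1 - Polynomial.C (y l) * Polynomial.X) : Polynomial R) :
        PowerSeries R) := by
  have h : ((∏ l ∈ Finset.univ.erase j, (1 - Polynomial.C (y l) * Polynomial.X) : Polynomial R) :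
      PowerSeries R) =
      ∏ l ∈ Finset.univ.erase j, (1 - PowerSeries.C (y l) * PowerSeries.X) := by
    rw [← Polynomial.coeToPowerSeries.ringHom_apply, map_prod]
    simp
  rw [h, ← Finset.mul_prod_erase _ _ (Finset.mem_univ j), mul_assoc, ← Finset.prod_mul_distrib,
    Finset.prod_eq_one, mul_one]
  intro l _
  rw [mul_comm, one_sub_mul_geometric]

theorem natDegree_prod_erase_lt (y : Fin n → R) (j : Fin n) :
    (∏ l ∈ Finset.univ.erase j, (1 - Polynomial.C (y l) * Polynomial.X)).natDegree < n := by
  have hn : 0 < n := j.pos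
  refine lt_of_le_of_lt (Polynomial.natDegree_prod_le _ _) ?_
  refine lt_of_le_of_lt (Finset.sum_le_card_nsmul _ _ 1 fun l _ => ?_) ?_
  · compute_degree
  · rw [Finset.card_erase_of_mem (Finset.mem_univ j), Finset.card_univ, Fintype.card_fin]
    simp only [smul_eq_mul, mul_one]
    omega

/-- The staircase lists the exponents 0, …, n-1 in reverse; in this order they match the columns of
the Jacobi–Trudi matrix. -/
theorem coe_eq_sum_stair {Q : Polynomial R} (hQ : Q.natDegree < n) :
    (Q : PowerSeries R) =
      ∑ r, PowerSeries.C (Q.coeff (stair n r)) * PowerSeries.X ^ stair n r := by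
  simp only [stair_eq_rev]
  refine Eq.trans ?_ (Equiv.sum_comp Fin.revPerm
    (fun r : Fin n => PowerSeries.C (Q.coeff r) * PowerSeries.X ^ (r : ℕ))).symm
  rw [← Finset.sum_range fun r => PowerSeries.C (Q.coeff r) * PowerSeries.X ^ r]
  conv_lhs => rw [Q.as_sum_range' n hQ, ← Polynomial.coeToPowerSeries.ringHom_apply, map_sum]
  refine Finset.sum_congr rfl fun r _ => ?_
  rw [Polynomial.coeToPowerSeries.ringHom_apply, ← Polynomial.C_mul_X_pow_eq_monomial]
  simp

/-- The bialternant formula. -/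
theorem alternant_eq_jacobiTrudi_mul (y : Fin n → R) (α : Fin n → ℕ) :
    alternant y α = jacobiTrudi (∏ l, PowerSeries.mk (y l ^ ·)) α * alternant y (stair n) := by
  set k : PowerSeries R := ∏ l, PowerSeries.mk (y l ^ ·) with hk
  set Q : Fin n → Polynomial R := fun j =>
    ∏ l ∈ Finset.univ.erase j, (1 - Polynomial.C (y l) * Polynomial.X) with hQ
  -- The matrix (y_j^{β_i}) is the Jacobi–Trudi matrix times a matrix independent of β. Taking β =
  -- δ, where the first determinant is 1, identifies the second as a_δ.
  have key : ∀ β, alternant y β =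
      jacobiTrudi k β * (Matrix.of fun r j => (Q j).coeff (stair n r)).det := by
    intro β
    rw [alternant, jacobiTrudi, ← Matrix.det_mul]
    congr 1
    ext i j
    have h : PowerSeries.coeff (β i) (PowerSeries.mk (y j ^ ·)) = y j ^ β i :=
      PowerSeries.coeff_mk _ _
    rw [Matrix.of_apply, ← h, geometric_eq_mul y j, coe_eq_sum_stair (natDegree_prod_erase_lt y j),
      Finset.mul_sum, map_sum, Matrix.mul_apply]
    refine Finset.sum_congr rfl fun r _ => ?_
    rw [Matrix.of_apply, Matrix.of_apply, mul_left_comm, PowerSeries.coeff_C_mul, mul_comm,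
      mul_comm (PowerSeries.X ^ _)]
  rw [key, key (stair n), jacobiTrudi_stair, one_mul]
  simp [hk]

end Alternant

/-! ### Coordinates in the Schur basis -/

section Schur

variable {n : ℕ} {μ : YoungDiagram}

theorem cells_eq_shape (hμ : μ.colLen 0 ≤ n) : μ.cells = shape (weight n μ) := by
  ext ⟨i, j⟩
  rw [mem_shape]
  constructor
  · intro hc
    exact ⟨row_lt hμ ⟨(i, j), hc⟩, YoungDiagram.mem_iff_lt_rowLen.1 hc⟩
  · rintro ⟨_, hc⟩
    exact YoungDiagram.mem_iff_lt_rowLen.2 hc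

theorem weight_antitone (n : ℕ) (μ : YoungDiagram) : Antitone (weight n μ) :=
  fun _ _ h => μ.rowLen_anti _ _ h

theorem isSemistandard_iff_isTableau (T : μ.cells → Fin n) :
    IsSemistandard T ↔ IsTableau (fun _ => False) T := by
  constructor
  · rintro ⟨h1, h2⟩
    have h3 : ∀ c d : μ.cells, c.1.2 = d.1.2 → T c = T d → ¬ c.1.1 < d.1.1 :=
      fun c d h e hlt => (h2 c d h hlt).ne e
    refine ⟨h1, fun c d h hle => ?_, fun c d h e _ => ?_, fun _ _ _ _ h => h.elim⟩
    · rcases hle.lt_or_eq with hlt | heq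
      · exact (h2 c d h hlt).le
      · rw [Subtype.ext (Prod.ext heq h)]
    · exact Subtype.ext (Prod.ext
        (le_antisymm (not_lt.1 (h3 d c h.symm e.symm)) (not_lt.1 (h3 c d h e))) h)
  · rintro ⟨h1, h2, h3, -⟩
    refine ⟨h1, fun c d h hlt => lt_of_le_of_ne (h2 c d h hlt.le) fun e => ?_⟩
    rw [h3 c d h e not_false] at hlt
    exact lt_irrefl _ hlt

theorem schurPoly_eq_tableauSum (n : ℕ) (μ : YoungDiagram) :
    schurPoly n μ = tableauSum (fun _ => False) X μ.cells := by
  refine Finset.sum_congr ?_ fun _ _ => rfl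
  ext T
  simp only [Finset.mem_filter, isSemistandard_iff_isTableau]

/-- For n unprimed letters of weights x_l the Jacobi–Trudi series is ∏ 1 / (1 - x_l X), the very
series of the bialternant formula. -/
theorem schurPoly_mul_alternant (hμ : μ.colLen 0 ≤ n) :
    schurPoly n μ * alternant X (stair n) = alternant X (⇑(weight n μ) + stair n) := by
  rw [alternant_eq_jacobiTrudi_mul X (_ + _), schurPoly_eq_tableauSum, cells_eq_shape hμ,
    ← jacobiTrudi_prod_letterSeries _ _ (weight_antitone n μ)]
  simp [letterSeries]

theorem prod_X_pow_eq_monomial {σ : Type*} [Fintype σ] (α : σ → ℕ) :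
    ∏ i, (X i : MvPolynomial σ ℂ) ^ α i = monomial (Finsupp.equivFunOnFinite.symm α) 1 := by
  rw [monomial_eq, C_1, one_mul, Finsupp.prod_fintype _ _ fun _ => pow_zero _]
  rfl

/-- The exponents occurring are the rearrangements α ∘ σ. If one is strictly decreasing, σ is
increasing and hence the identity. -/
theorem coeff_alternant {α β : Fin n → ℕ} (hα : StrictAnti α) (hβ : StrictAnti β) :
    coeff (Finsupp.equivFunOnFinite.symm β) (alternant (X : Fin n → MvPolynomial (Fin n) ℂ) α) =
      if α = β then 1 else 0 := by
  classical
  have hσ : ∀ σ : Equiv.Perm (Fin n), α ∘ σ = β → σ = 1 := by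
    intro σ h
    have hmono : StrictMono σ := fun i j hij => by
      have := hβ hij
      rw [← h] at this
      exact hα.lt_iff_gt.1 this
    exact DFunLike.coe_injective (StrictMono.range_inj hmono strictMono_id |>.1 (by simp [σ.surjective.range_eq]))
  have hterm : ∀ σ : Equiv.Perm (Fin n), coeff (Finsupp.equivFunOnFinite.symm β)
      (((Equiv.Perm.sign σ : ℤ) : MvPolynomial (Fin n) ℂ) * ∏ i, X i ^ α (σ i)) =
        if α ∘ σ = β then (Equiv.Perm.sign σ : ℂ) else 0 := by
    intro σ
    rw [prod_X_pow_eq_monomial fun i => α (σ i), ← map_intCast (C : ℂ →+* _), coeff_C_mul,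
      coeff_monomial, mul_ite, mul_one, mul_zero]
    simp only [EmbeddingLike.apply_eq_iff_eq]
    rfl
  rw [alternant_eq_sum, coeff_sum, Finset.sum_congr rfl fun σ _ => hterm σ,
    Finset.sum_eq_single 1]
  · simp
  · intro σ _ hne
    exact if_neg fun h => hne (hσ σ h)
  · simp

/-- The coordinates in the Schur basis are coefficients of the product with the Vandermonde
alternant. -/
theorem schurBasis_coord (μ : {μ : YoungDiagram // μ.colLen 0 ≤ n})
    (g : symmetricSubalgebra (Fin n) ℂ) : (schurBasis n).coord μ g =
      coeff (Finsupp.equivFunOnFinite.symm (⇑(weight n μ.1) + stair n))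
        (alternant X (stair n) * (g : MvPolynomial (Fin n) ℂ)) := by
  classical
  -- Both sides are linear in `g`. At S_ν the product is a_{ν+δ}, whose coefficient at x^{μ+δ} tests
  -- ν = μ.
  have h : (schurBasis n).coord μ =
      lcoeff ℂ (Finsupp.equivFunOnFinite.symm (⇑(weight n μ.1) + stair n)) ∘ₗ
        LinearMap.mulLeft ℂ (alternant X (stair n)) ∘ₗ
          (symmetricSubalgebra (Fin n) ℂ).val.toLinearMap := by
    refine (schurBasis n).ext fun ν => ?_
    simp only [Module.Basis.coord_apply, Module.Basis.repr_self, LinearMap.coe_comp,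
      Function.comp_apply, LinearMap.mulLeft_apply, AlgHom.toLinearMap_apply,
      Subalgebra.coe_val, lcoeff_apply, schurBasis_apply]
    rw [mul_comm, schurPoly_mul_alternant ν.2,
      coeff_alternant (add_stair_strictAnti (weight_antitone n _))
        (add_stair_strictAnti (weight_antitone n _)), Finsupp.single_apply]
    refine if_congr ⟨fun h => by rw [h], fun h => ?_⟩ rfl rfl
    exact Subtype.ext (weight_injective ν.2 μ.2 (DFunLike.coe_injective (add_right_cancel h)))
  rw [h]
  rfl

end Schur

/-! ### Jacobi–Trudi for hook Schur polynomials -/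

section HookSeries

variable {R : Type*} [CommRing R] {n k l : ℕ}

theorem tableauSum_orderIso {A B : Type*} [LE A] [LE B] [Fintype A] [Fintype B] (e : A ≃o B)
    (p : B → Prop) (w : B → R) (s : Finset (ℕ × ℕ)) :
    tableauSum (fun a => p (e a)) (fun a => w (e a)) s = tableauSum p w s := by
  classical
  refine Finset.sum_equiv ((Equiv.refl s).arrowCongr e.toEquiv) ?_ ?_
  · intro T
    simp [IsTableau]
  · intro T _
    simp

/-- Concatenation of two alphabets. -/
def finSumLexOrderIso (k l : ℕ) : Fin k ⊕ₗ Fin l ≃o Fin (k + l) where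
  toEquiv := ofLex.trans finSumFinEquiv
  map_rel_iff' := by
    intro a b
    rcases a with a | a <;> rcases b with b | b
    · exact (Sum.Lex.inl_le_inl_iff (a := a) (b := b)).symm
    · refine iff_of_true ?_ (Sum.Lex.inl_le_inr a b)
      exact Fin.le_def.2 (by change a.val ≤ k + b.val; omega)
    · refine iff_of_false ?_ Sum.Lex.not_inr_le_inl
      exact fun h => absurd (Fin.le_def.1 h) (by change ¬ (k + a.val ≤ b.val); omega)
    · refine Iff.trans ?_ (Sum.Lex.inr_le_inr_iff (a := a) (b := b)).symm
      rw [Fin.le_def, Fin.le_def]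
      change k + a.val ≤ k + b.val ↔ _
      omega

/-- The power series `∏ (1 + z_j X) / ∏ (1 - y_j X)`. -/
noncomputable def hookSeries (w : Fin k ⊕ Fin l → R) : PowerSeries R :=
  (∏ j, (1 + PowerSeries.C (w (Sum.inr j)) * PowerSeries.X)) *
    ∏ j, PowerSeries.mk (w (Sum.inl j) ^ ·)

theorem isHookSemistandard_iff_isTableau {μ : YoungDiagram} (T : μ.cells → Fin k ⊕ₗ Fin l) :
    IsHookSemistandard T ↔ IsTableau (fun a => ∃ b, a = Sum.inrₗ b) T := by
  have h : ∀ a : Fin k ⊕ₗ Fin l, (¬ ∃ b, a = Sum.inrₗ b) ↔ ∃ b, a = Sum.inlₗ b := by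
    rintro (a | a)
    · exact iff_of_true (fun ⟨b, hb⟩ => Sum.inl_ne_inr hb) ⟨a, rfl⟩
    · exact iff_of_false (fun h => h ⟨a, rfl⟩) (fun ⟨b, hb⟩ => Sum.inr_ne_inl hb)
  simp only [IsHookSemistandard, IsTableau, h]

/-- A general homomorphism `φ` serves both parts of the theorem: the inclusion into power series for
the pairing, and evaluation at complex numbers for the integral. -/
theorem map_hookSchur (φ : MvPolynomial (Fin k ⊕ Fin l) ℂ →+* R) {μ : YoungDiagram}
    (hμ : μ.colLen 0 ≤ n) : φ (hookSchur k l μ) =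
      jacobiTrudi (hookSeries fun a => φ (X a)) (⇑(weight n μ) + stair n) := by
  have h1 : φ (hookSchur k l μ) =
      tableauSum (fun a => ∃ b, a = Sum.inrₗ b) (fun a => φ (X (ofLex a))) μ.cells := by
    rw [hookSchur, map_sum]
    refine Finset.sum_congr ?_ fun _ _ => map_prod _ _ _
    ext T
    simp only [Finset.mem_filter, isHookSemistandard_iff_isTableau]
  have h2 := tableauSum_orderIso (finSumLexOrderIso k l)
    (fun a => ∃ b, (finSumLexOrderIso k l).symm a = Sum.inrₗ b)
    (fun a => φ (X (ofLex ((finSumLexOrderIso k l).symm a)))) μ.cells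
  simp only [OrderIso.symm_apply_apply] at h2
  rw [h1, h2, cells_eq_shape hμ, ← jacobiTrudi_prod_letterSeries _ _ (weight_antitone n μ),
    Fin.prod_univ_add, mul_comm, hookSeries]
  have el : ∀ j, (finSumLexOrderIso k l).symm (Fin.castAdd l j) = toLex (Sum.inl j) := fun j =>
    (OrderIso.symm_apply_eq _).2 rfl
  have er : ∀ j, (finSumLexOrderIso k l).symm (Fin.natAdd k j) = toLex (Sum.inr j) := fun j =>
    (OrderIso.symm_apply_eq _).2 rfl
  congr 2
  · refine Finset.prod_congr rfl fun j _ => ?_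
    rw [letterSeries, if_pos ⟨j, er j⟩, er, ofLex_toLex]
  · refine Finset.prod_congr rfl fun j _ => ?_
    rw [letterSeries, if_neg, el, ofLex_toLex]
    rw [el]
    exact fun ⟨b, hb⟩ => Sum.inl_ne_inr hb

end HookSeries

/-! ### Exchanging the roles of the two sets of variables -/

section Swap

variable {σ τ R : Type*} [CommRing R]

/-- The family of coefficients of a power series whose coefficients are polynomials in `σ`, regarded
as a power series in `σ`. -/
noncomputable def swapCoeffs (P : MvPowerSeries τ (MvPolynomial σ R)) :
    MvPowerSeries σ (MvPowerSeries τ R) :=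
  fun γ d => MvPolynomial.coeff γ (MvPowerSeries.coeff d P)

theorem coeff_coeff_swapCoeffs (P : MvPowerSeries τ (MvPolynomial σ R)) (γ : σ →₀ ℕ)
    (d : τ →₀ ℕ) : MvPowerSeries.coeff d (MvPowerSeries.coeff γ (swapCoeffs P)) =
      MvPolynomial.coeff γ (MvPowerSeries.coeff d P) := rfl

/-- A power series whose coefficients are polynomials in `σ`, regarded as a power series in `σ`. -/
noncomputable def swapSeries :
    MvPowerSeries τ (MvPolynomial σ R) →+* MvPowerSeries σ (MvPowerSeries τ R) where
  toFun := swapCoeffs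
  map_one' := by
    classical
    refine MvPowerSeries.ext fun γ => MvPowerSeries.ext fun d => ?_
    rw [coeff_coeff_swapCoeffs, MvPowerSeries.coeff_one, MvPowerSeries.coeff_one]
    by_cases hd : d = 0 <;> by_cases hγ : γ = 0 <;>
      simp [hd, hγ, MvPowerSeries.coeff_one, MvPolynomial.coeff_one, eq_comm]
  map_mul' P Q := by
    classical
    refine MvPowerSeries.ext fun γ => MvPowerSeries.ext fun d => ?_
    simp only [coeff_coeff_swapCoeffs, MvPowerSeries.coeff_mul, MvPolynomial.coeff_sum,
      MvPolynomial.coeff_mul, map_sum]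
    exact Finset.sum_comm
  map_zero' := by
    refine MvPowerSeries.ext fun γ => MvPowerSeries.ext fun d => ?_
    simp only [coeff_coeff_swapCoeffs, map_zero, MvPolynomial.coeff_zero]
  map_add' P Q := by
    refine MvPowerSeries.ext fun γ => MvPowerSeries.ext fun d => ?_
    simp only [coeff_coeff_swapCoeffs, map_add, MvPolynomial.coeff_add]

theorem coeff_coeff_swapSeries (P : MvPowerSeries τ (MvPolynomial σ R)) (γ : σ →₀ ℕ)
    (d : τ →₀ ℕ) : MvPowerSeries.coeff d (MvPowerSeries.coeff γ (swapSeries P)) =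
      MvPolynomial.coeff γ (MvPowerSeries.coeff d P) := rfl

theorem swapSeries_C_X (i : σ) :
    swapSeries (MvPowerSeries.C (X i) : MvPowerSeries τ (MvPolynomial σ R)) =
      MvPowerSeries.X i := by
  classical
  ext γ d
  rw [coeff_coeff_swapSeries, MvPowerSeries.coeff_C, MvPowerSeries.coeff_X]
  by_cases hd : d = 0 <;> by_cases hγ : γ = Finsupp.single i 1 <;>
    simp [hd, hγ, MvPowerSeries.coeff_one, MvPolynomial.coeff_X, eq_comm]

theorem swapSeries_X (s : τ) :
    swapSeries (MvPowerSeries.X s : MvPowerSeries τ (MvPolynomial σ R)) =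
      MvPowerSeries.C (MvPowerSeries.X s) := by
  classical
  ext γ d
  rw [coeff_coeff_swapSeries, MvPowerSeries.coeff_C, MvPowerSeries.coeff_X]
  by_cases hd : d = Finsupp.single s 1 <;> by_cases hγ : γ = 0 <;>
    simp [hd, hγ, MvPowerSeries.coeff_X, MvPolynomial.coeff_one, eq_comm]

/-- Substitution of the variable `i` into a power series in one variable. -/
noncomputable def inVar (i : σ) : PowerSeries R →+* MvPowerSeries σ R :=
  (MvPowerSeries.rename (R := R) fun _ : Unit => i).toRingHom

theorem inVar_X (i : σ) : inVar i (PowerSeries.X : PowerSeries R) = MvPowerSeries.X i :=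
  MvPowerSeries.rename_X _ _

theorem inVar_C (i : σ) (r : R) : inVar i (PowerSeries.C r) = MvPowerSeries.C r :=
  MvPowerSeries.rename_C _ _

theorem coeff_single_inVar (i : σ) (r : ℕ) (g : PowerSeries R) :
    MvPowerSeries.coeff (Finsupp.single i r) (inVar i g) = PowerSeries.coeff r g := by
  have h := MvPowerSeries.coeff_embDomain_rename ⟨fun _ : Unit => i, fun _ _ _ => rfl⟩ g
    (Finsupp.single () r)
  rw [Finsupp.embDomain_single] at h
  exact h

theorem coeff_inVar_of_ne (i : σ) {γ : σ →₀ ℕ} (h : γ ≠ Finsupp.single i (γ i))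
    (g : PowerSeries R) : MvPowerSeries.coeff γ (inVar i g) = 0 := by
  refine MvPowerSeries.coeff_rename_eq_zero _ g ?_
  rintro ⟨β, rfl⟩
  refine h ?_
  obtain ⟨r, rfl⟩ : ∃ r, β = Finsupp.single () r := ⟨β (), by ext; simp⟩
  simp [Finsupp.mapDomain_single]

/-- The `i`-th factor involves the variable `i` alone, so the only splitting of `γ` that contributes
gives it the exponent `γ i` of that variable. -/
theorem coeff_prod_inVar [Fintype σ] (g : σ → PowerSeries R) (γ : σ →₀ ℕ) :
    MvPowerSeries.coeff γ (∏ i, inVar i (g i)) = ∏ i, PowerSeries.coeff (γ i) (g i) := by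
  classical
  rw [MvPowerSeries.coeff_prod,
    Finset.sum_eq_single (Finsupp.equivFunOnFinite.symm fun i => Finsupp.single i (γ i))]
  · refine Finset.prod_congr rfl fun i _ => ?_
    exact coeff_single_inVar i _ _
  · intro L hL hne
    rw [Finset.mem_finsuppAntidiag] at hL
    by_contra h0
    have hs : ∀ i, L i = Finsupp.single i (L i i) := fun i => by
      by_contra h
      exact h0 (Finset.prod_eq_zero (Finset.mem_univ i) (coeff_inVar_of_ne i h _))
    refine hne (Finsupp.ext fun i => ?_)
    have hi : γ i = L i i := by
      rw [← hL.1, Finsupp.finsetSum_apply, Finset.sum_eq_single i]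
      · intro j _ hji
        rw [hs j, Finsupp.single_eq_of_ne hji.symm]
      · simp
    rw [Finsupp.equivFunOnFinite_symm_apply_apply, hi, ← hs]
  · intro h
    refine absurd (Finset.mem_finsuppAntidiag.2 ⟨?_, Finset.subset_univ _⟩) h
    ext j
    simp

end Swap

/-! ### The formal identity -/

section FormalIdentity

variable {n k l : ℕ}

theorem inVar_hookSeries {σ R : Type*} [CommRing R] (i : σ) (w : Fin k ⊕ Fin l → R) :
    inVar i (hookSeries w) =
      inVar i (∏ j, (1 + PowerSeries.C (w (Sum.inr j)) * PowerSeries.X)) *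
        inVar i (∏ j, PowerSeries.mk (w (Sum.inl j) ^ ·)) :=
  map_mul _ _ _

/-- Regarded as a series in x over ℂ[[y, z]], the kernel is ∏ K(x_i). Its inverse factors are
matched by uniqueness of inverses, both candidates being inverse to 1 - x_i y_j. -/
theorem swapSeries_kernel : swapSeries (kernel n k l) =
    ∏ i, inVar i (hookSeries fun a => (MvPowerSeries.X a : MvPowerSeries (Fin k ⊕ Fin l) ℂ)) := by
  have hy : ∀ (i : Fin n) (a : Fin k ⊕ Fin l),
      swapSeries (MvPowerSeries.invOfUnit (1 - MvPowerSeries.C (X i) * MvPowerSeries.X a) 1) =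
        inVar i (PowerSeries.mk ((MvPowerSeries.X a : MvPowerSeries (Fin k ⊕ Fin l) ℂ) ^ ·)) := by
    intro i a
    have h0 : swapSeries (1 - MvPowerSeries.C (X i) * MvPowerSeries.X a) = inVar i (1 - PowerSeries.C
        (MvPowerSeries.X a : MvPowerSeries (Fin k ⊕ Fin l) ℂ) * PowerSeries.X) := by
      rw [map_sub, map_sub, map_one, map_one, map_mul, map_mul, swapSeries_C_X, swapSeries_X,
        inVar_X, inVar_C, mul_comm]
    have h1 := congrArg swapSeries (mul_invOfUnit_linear (X i : MvPolynomial (Fin n) ℂ) a)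
    have h2 := congrArg (inVar i)
      (one_sub_mul_geometric (MvPowerSeries.X a : MvPowerSeries (Fin k ⊕ Fin l) ℂ))
    rw [map_mul, map_one, h0] at h1
    rw [map_mul, map_one] at h2
    exact left_inv_eq_right_inv ((mul_comm _ _).trans h1) h2
  have hz : ∀ (i : Fin n) (a : Fin k ⊕ Fin l),
      swapSeries (1 + MvPowerSeries.C (X i) * MvPowerSeries.X a) = inVar i (1 + PowerSeries.C
        (MvPowerSeries.X a : MvPowerSeries (Fin k ⊕ Fin l) ℂ) * PowerSeries.X) := by
    intro i a
    rw [map_add, map_add, map_one, map_one, map_mul, map_mul, swapSeries_C_X, swapSeries_X, inVar_X,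
      inVar_C, mul_comm]
  rw [kernel, map_mul, map_prod, map_prod,
    Finset.prod_congr rfl fun i _ => inVar_hookSeries i _, Finset.prod_mul_distrib]
  refine congrArg₂ _ (Finset.prod_congr rfl fun i _ => ?_) (Finset.prod_congr rfl fun i _ => ?_)
  · rw [map_prod, map_prod]
    exact Finset.prod_congr rfl fun j _ => hz i _
  · rw [map_prod, map_prod]
    exact Finset.prod_congr rfl fun j _ => hy i _

theorem coeff_coeff_kernel (d : Fin k ⊕ Fin l →₀ ℕ) (γ : Fin n →₀ ℕ) :
    coeff γ (MvPowerSeries.coeff d (kernel n k l)) = MvPowerSeries.coeff d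
      (∏ i, PowerSeries.coeff (γ i)
        (hookSeries fun a => (MvPowerSeries.X a : MvPowerSeries (Fin k ⊕ Fin l) ℂ))) := by
  rw [← coeff_coeff_swapSeries, swapSeries_kernel, coeff_prod_inVar]

/-- The σ-term of the alternant shifts exponents, so it picks from ∏ K(x_i) the coefficient ∏ K_{α_i
- δ_{σ(i)}}, read as zero if an index is negative. The signed sum over σ is the determinant. -/
theorem coeff_alternant_mul_kernelCoeff (d : Fin k ⊕ Fin l →₀ ℕ) (α : Fin n → ℕ) :
    coeff (Finsupp.equivFunOnFinite.symm α)
      (alternant X (stair n) * (kernelCoeff n k l d : MvPolynomial (Fin n) ℂ)) =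
    MvPowerSeries.coeff d (jacobiTrudi
      (hookSeries fun a => (MvPowerSeries.X a : MvPowerSeries (Fin k ⊕ Fin l) ℂ)) α) := by
  classical
  rw [alternant_eq_sum, Finset.sum_mul, coeff_sum, jacobiTrudi, ← Matrix.det_transpose,
    Matrix.det_apply', map_sum]
  refine Finset.sum_congr rfl fun σ _ => ?_
  rw [prod_X_pow_eq_monomial fun i => stair n (σ i), ← map_intCast (C : ℂ →+* _), mul_assoc,
    coeff_C_mul, ← map_intCast (MvPowerSeries.C : ℂ →+* _), MvPowerSeries.coeff_C_mul,
    coeff_monomial_mul', one_mul]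
  congr 1
  simp only [Matrix.transpose_apply, Matrix.of_apply, PowerSeries.coeff_X_pow_mul']
  split_ifs with h
  · rw [kernelCoeff, coeff_coeff_kernel]
    congr 1
    exact Finset.prod_congr rfl fun i _ => (if_pos (h i)).symm
  · obtain ⟨i, hi⟩ : ∃ i, ¬ stair n (σ i) ≤ α i := by
      by_contra! hle
      exact h hle
    rw [Finset.prod_eq_zero (Finset.mem_univ i) (if_neg hi), map_zero]

/-- By linearity it is enough to take f = S_μ. Pairing with S_μ reads off the μ-coordinate of the
kernel coefficient, a coefficient of the Jacobi–Trudi determinant for HS_μ. -/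
theorem coe_digamma_eq_kernelPairing (f : symmetricSubalgebra (Fin n) ℂ) :
    (digamma n k l f : MvPowerSeries (Fin k ⊕ Fin l) ℂ) = kernelPairing n k l f := by
  ext d
  rw [MvPolynomial.coeff_coe]
  have h : lcoeff ℂ d ∘ₗ digamma n k l = (schurInner n).flip (kernelCoeff n k l d) := by
    refine (schurBasis n).ext fun μ => ?_
    rw [LinearMap.comp_apply, lcoeff_apply, LinearMap.flip_apply, digamma, schurInner,
      Module.Basis.constr_basis, Module.Basis.constr_basis, schurBasis_coord,
      coeff_alternant_mul_kernelCoeff]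
    have := map_hookSchur (k := k) (l := l) (MvPolynomial.coeToMvPowerSeries.ringHom) μ.2
    simp only [MvPolynomial.coeToMvPowerSeries.ringHom_apply, MvPolynomial.coe_X] at this
    rw [← this, MvPolynomial.coeff_coe]
  exact congrArg (fun g => g f) h

end FormalIdentity

/-! ### Absolutely convergent series on the circle and their Fourier coefficients -/

section FourierSeries

open Complex MeasureTheory

/-- `g` is, on the unit circle, the sum of the absolutely convergent series `∑ c_r x⁻ʳ`. -/
def IsCircleSum (g : ℂ → ℂ) (c : PowerSeries ℂ) : Prop :=
  (Summable fun r => ‖PowerSeries.coeff r c‖) ∧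
    ∀ x : ℂ, ‖x‖ = 1 → HasSum (fun r => PowerSeries.coeff r c * x⁻¹ ^ r) (g x)

theorem norm_mul_inv_pow (a : ℂ) {x : ℂ} (hx : ‖x‖ = 1) (r : ℕ) : ‖a * x⁻¹ ^ r‖ = ‖a‖ := by
  simp [hx]

theorem IsCircleSum.mul {g g' : ℂ → ℂ} {c c' : PowerSeries ℂ} (h : IsCircleSum g c)
    (h' : IsCircleSum g' c') : IsCircleSum (fun x => g x * g' x) (c * c') := by
  have hs := summable_norm_sum_mul_antidiagonal_of_summable_norm h.1 h'.1
  have hs' : Summable fun r => ‖PowerSeries.coeff r (c * c')‖ := by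
    simpa only [PowerSeries.coeff_mul] using hs
  refine ⟨hs', fun x hx => ?_⟩
  have e : ∀ r, PowerSeries.coeff r (c * c') * x⁻¹ ^ r =
      ∑ p ∈ Finset.HasAntidiagonal.antidiagonal r, (PowerSeries.coeff p.1 c * x⁻¹ ^ p.1) *
        (PowerSeries.coeff p.2 c' * x⁻¹ ^ p.2) := by
    intro r
    rw [PowerSeries.coeff_mul, Finset.sum_mul]
    refine Finset.sum_congr rfl fun p hp => ?_
    rw [← Finset.HasAntidiagonal.mem_antidiagonal.1 hp, pow_add]
    ring
  have hsum : Summable fun r => PowerSeries.coeff r (c * c') * x⁻¹ ^ r :=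
    Summable.of_norm (by simpa only [norm_mul_inv_pow _ hx] using hs')
  change HasSum _ (g x * g' x)
  rw [← (h.2 x hx).tsum_eq, ← (h'.2 x hx).tsum_eq,
    tsum_mul_tsum_eq_tsum_sum_antidiagonal_of_summable_norm
      (by simpa only [norm_mul_inv_pow _ hx] using h.1)
      (by simpa only [norm_mul_inv_pow _ hx] using h'.1)]
  simp only [← e]
  exact hsum.hasSum

theorem isCircleSum_coe (p : Polynomial ℂ) : IsCircleSum (fun x => p.eval x⁻¹) p := by
  have h0 : ∀ r ∉ p.support, PowerSeries.coeff r (p : PowerSeries ℂ) = 0 := fun r hr => by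
    rw [Polynomial.coeff_coe, Polynomial.notMem_support_iff.1 hr]
  refine ⟨summable_of_ne_finset_zero (s := p.support) fun r hr => by rw [h0 r hr, norm_zero],
    fun x _ => ?_⟩
  have : HasSum (fun r => PowerSeries.coeff r (p : PowerSeries ℂ) * x⁻¹ ^ r)
      (∑ r ∈ p.support, PowerSeries.coeff r (p : PowerSeries ℂ) * x⁻¹ ^ r) :=
    hasSum_sum_of_ne_finset_zero fun r hr => by rw [h0 r hr, zero_mul]
  change HasSum _ (p.eval x⁻¹)
  rw [Polynomial.eval_eq_sum, Polynomial.sum]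
  simpa only [Polynomial.coeff_coe] using this

theorem isCircleSum_one : IsCircleSum (fun _ => 1) 1 := by
  simpa using isCircleSum_coe 1

theorem isCircleSum_X_pow (b : ℕ) : IsCircleSum (fun x => x⁻¹ ^ b) (PowerSeries.X ^ b) := by
  simpa using isCircleSum_coe (Polynomial.X ^ b)

theorem isCircleSum_one_add (z : ℂ) :
    IsCircleSum (fun x => 1 + z * x⁻¹) (1 + PowerSeries.C z * PowerSeries.X) := by
  have h := isCircleSum_coe (1 + Polynomial.C z * Polynomial.X)
  rw [Polynomial.coe_add, Polynomial.coe_one, Polynomial.coe_mul, Polynomial.coe_C,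
    Polynomial.coe_X] at h
  simpa only [Polynomial.eval_add, Polynomial.eval_one, Polynomial.eval_mul, Polynomial.eval_C,
    Polynomial.eval_X] using h

theorem isCircleSum_geometric {y : ℂ} (hy : ‖y‖ < 1) :
    IsCircleSum (fun x => (1 - y * x⁻¹)⁻¹) (PowerSeries.mk (y ^ ·)) := by
  refine ⟨?_, fun x hx => ?_⟩
  · simpa using summable_geometric_of_lt_one (norm_nonneg y) hy
  · have := hasSum_geometric_of_norm_lt_one (ξ := y * x⁻¹) (by simpa [hx] using hy)
    simpa [mul_pow] using this

theorem isCircleSum_prod {ι : Type*} (s : Finset ι) {g : ι → ℂ → ℂ} {c : ι → PowerSeries ℂ}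
    (h : ∀ i, IsCircleSum (g i) (c i)) : IsCircleSum (fun x => ∏ i ∈ s, g i x) (∏ i ∈ s, c i) := by
  classical
  induction s using Finset.induction_on with
  | empty => simpa using isCircleSum_one
  | insert i s hi ih => simpa only [Finset.prod_insert hi] using (h i).mul ih

theorem IsCircleSum.continuous {g : ℂ → ℂ} {c : PowerSeries ℂ} (h : IsCircleSum g c) :
    Continuous fun θ : ℝ => g (exp (θ * I)) := by
  have e : (fun θ : ℝ => g (exp (θ * I))) =
      fun θ : ℝ => ∑' r, PowerSeries.coeff r c * (exp (θ * I))⁻¹ ^ r :=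
    funext fun θ => (h.2 _ (norm_exp_ofReal_mul_I θ)).tsum_eq.symm
  rw [e]
  refine continuous_tsum (fun r => ?_) h.1 fun r θ =>
    (norm_mul_inv_pow _ (norm_exp_ofReal_mul_I θ) r).le
  have : Continuous fun θ : ℝ => (exp (θ * I))⁻¹ :=
    Continuous.inv₀ (by fun_prop) fun θ => exp_ne_zero _
  exact continuous_const.mul (this.pow r)

theorem integral_exp_pow_mul_inv_pow (a r : ℕ) :
    ∫ θ : ℝ in Set.Icc 0 (2 * Real.pi), exp (θ * I) ^ a * (exp (θ * I))⁻¹ ^ r =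
      if r = a then (2 * Real.pi : ℂ) else 0 := by
  have e : ∀ θ : ℝ, exp (θ * I) ^ a * (exp (θ * I))⁻¹ ^ r = exp (((a : ℂ) - r) * I * θ) := by
    intro θ
    rw [← exp_neg, ← exp_nat_mul, ← exp_nat_mul, ← exp_add]
    congr 1
    ring
  simp only [e]
  rw [integral_Icc_eq_integral_Ioc, ← intervalIntegral.integral_of_le Real.two_pi_pos.le]
  split_ifs with h
  · simp [h]
  · have hne : ((a : ℂ) - r) * I ≠ 0 :=
      mul_ne_zero (sub_ne_zero.2 fun h' => h (Nat.cast_injective h').symm) I_ne_zero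
    rw [integral_exp_mul_complex hne]
    have h1 : ((a : ℂ) - r) * I * ((2 * Real.pi : ℝ) : ℂ) =
        ((a : ℤ) - (r : ℤ) : ℤ) * (2 * Real.pi * I) := by
      push_cast
      ring
    rw [h1, exp_int_mul_two_pi_mul_I]
    simp

/-- The norms of the terms are constant on the circle and summable, so the series may be integrated
term by term; only r = a survives orthogonality. -/
theorem IsCircleSum.integral {g : ℂ → ℂ} {c : PowerSeries ℂ} (h : IsCircleSum g c) (a : ℕ) :
    ∫ θ : ℝ in Set.Icc 0 (2 * Real.pi), exp (θ * I) ^ a * g (exp (θ * I)) =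
      2 * Real.pi * PowerSeries.coeff a c := by
  set F : ℕ → ℝ → ℂ := fun r θ =>
    PowerSeries.coeff r c * (exp (θ * I) ^ a * (exp (θ * I))⁻¹ ^ r) with hF
  have hnorm : ∀ r θ, ‖F r θ‖ = ‖PowerSeries.coeff r c‖ := by
    intro r θ
    simp [hF, norm_exp_ofReal_mul_I]
  have hcont : ∀ r, Continuous (F r) := by
    intro r
    have : Continuous fun θ : ℝ => (exp (θ * I))⁻¹ :=
      Continuous.inv₀ (by fun_prop) fun θ => exp_ne_zero _
    fun_prop
  have hsum : Summable fun r => ∫ θ in Set.Icc 0 (2 * Real.pi), ‖F r θ‖ := by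
    simp only [hnorm, setIntegral_const, smul_eq_mul]
    exact h.1.mul_left _
  have key := hasSum_integral_of_summable_integral_norm
    (fun r => (hcont r).integrableOn_Icc (a := 0) (b := 2 * Real.pi)) hsum
  have e1 : ∀ θ : ℝ, ∑' r, F r θ = exp (θ * I) ^ a * g (exp (θ * I)) := by
    intro θ
    rw [← (h.2 _ (norm_exp_ofReal_mul_I θ)).tsum_eq, ← tsum_mul_left]
    exact tsum_congr fun r => by simp only [hF]; ring
  have e2 : ∀ r, ∫ θ in Set.Icc 0 (2 * Real.pi), F r θ =
      if r = a then 2 * Real.pi * PowerSeries.coeff a c else 0 := by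
    intro r
    simp only [hF]
    rw [integral_const_mul, integral_exp_pow_mul_inv_pow]
    split_ifs with hr
    · rw [hr, mul_comm]
    · rw [mul_zero]
  simp only [e1, e2] at key
  exact key.unique (hasSum_ite_eq a _)

variable {n : ℕ}

theorem volume_restrict_Icc_eq_pi :
    (volume : Measure (Fin n → ℝ)).restrict (Set.Icc (0 : Fin n → ℝ) fun _ => 2 * Real.pi) =
      Measure.pi fun _ => (volume : Measure ℝ).restrict (Set.Icc 0 (2 * Real.pi)) := by
  rw [← Set.pi_univ_Icc, volume_pi, Measure.restrict_pi_pi]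
  rfl

theorem IsCircleSum.integral_prod {g : Fin n → ℂ → ℂ} {c : Fin n → PowerSeries ℂ}
    (h : ∀ i, IsCircleSum (g i) (c i)) (a : Fin n → ℕ) :
    ∫ θ : Fin n → ℝ in Set.Icc 0 fun _ => 2 * Real.pi,
      ∏ i, exp (θ i * I) ^ a i * g i (exp (θ i * I)) =
        (2 * Real.pi) ^ n * ∏ i, PowerSeries.coeff (a i) (c i) := by
  rw [volume_restrict_Icc_eq_pi, integral_fintype_prod_eq_prod
    (fun i (t : ℝ) => exp (t * I) ^ a i * g i (exp (t * I))),
    Finset.prod_congr rfl fun i _ => (h i).integral (a i), Finset.prod_mul_distrib]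
  simp

end FourierSeries

/-! ### Integration against the Weyl density -/

section WeylIntegral

open Complex MeasureTheory

variable {n : ℕ}

/-- Opposite factors pair up: (1 - x_i/x_j)(1 - x_j/x_i) = (x_j - x_i)(x_j⁻¹ - x_i⁻¹). Each
alternant is a Vandermonde determinant up to the sign of the order reversal, which occurs twice. -/
theorem prod_one_sub_div_eq {x : Fin n → ℂ} (hx : ∀ i, x i ≠ 0) :
    ∏ i, ∏ j with i ≠ j, (1 - x i / x j) =
      alternant x (stair n) * alternant (fun i => (x i)⁻¹) (stair n) := by
  have hV : ∀ y : Fin n → ℂ, alternant y (stair n) =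
      Equiv.Perm.sign (Fin.revPerm : Equiv.Perm (Fin n)) * (Matrix.vandermonde y).det := by
    intro y
    rw [← Matrix.det_transpose (Matrix.vandermonde y), ← Matrix.det_permute, alternant]
    congr 1
    ext i j
    simp [stair_eq_rev, Matrix.vandermonde_apply]
  have hs : ((Equiv.Perm.sign (Fin.revPerm : Equiv.Perm (Fin n)) : ℤ) : ℂ) *
      ((Equiv.Perm.sign (Fin.revPerm : Equiv.Perm (Fin n)) : ℤ) : ℂ) = 1 := by
    rw [← Int.cast_mul, ← Units.val_mul, Int.units_mul_self]
    simp
  rw [hV, hV, mul_mul_mul_comm, hs, one_mul, Matrix.det_vandermonde, Matrix.det_vandermonde,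
    ← Finset.prod_mul_distrib]
  have h := Finset.prod_prod_Ioi_mul_eq_prod_prod_off_diag fun i j : Fin n => 1 - x j / x i
  have e : ∀ i : Fin n, (Finset.univ.filter fun j => i ≠ j) = {i}ᶜ := by
    intro i
    ext j
    simp [eq_comm]
  simp only [e]
  rw [← h]
  refine Finset.prod_congr rfl fun i _ => ?_
  rw [← Finset.prod_mul_distrib]
  refine Finset.prod_congr rfl fun j _ => ?_
  have := hx i
  have := hx j
  field_simp

/-- The integrand of `weylIntegral`, up to a constant factor. -/
noncomputable def weylIntegrand (g : ℂ → ℂ) (f : MvPolynomial (Fin n) ℂ) (x : Fin n → ℂ) : ℂ :=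
  eval x f * alternant x (stair n) * alternant (fun i => (x i)⁻¹) (stair n) * ∏ i, g (x i)

/-- In angular coordinates dx_i = √-1 x_i dθ_i, which cancels the x_i⁻¹ and the powers of √-1. -/
theorem weylIntegral_eq (g : ℂ → ℂ) (f : MvPolynomial (Fin n) ℂ) :
    weylIntegral n (fun x => eval x f * ∏ i, g (x i)) =
      ((2 * Real.pi) ^ n * n.factorial : ℂ)⁻¹ *
        ∫ θ : Fin n → ℝ in Set.Icc 0 fun _ => 2 * Real.pi,
          weylIntegrand g f fun i => exp (θ i * I) := by
  rw [weylIntegral, torusIntegral, ← integral_const_mul]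
  congr 1
  funext θ
  obtain ⟨x, hx⟩ : ∃ x : Fin n → ℂ, ∀ i, exp (θ i * I) = x i := ⟨_, fun _ => rfl⟩
  have hT : torusMap 0 1 θ = x := by
    funext i
    simp [torusMap, hx]
  have h0 : ∀ i, x i ≠ 0 := fun i => hx i ▸ exp_ne_zero _
  simp only [hT, hx]
  rw [prod_one_sub_div_eq h0, weylIntegrand]
  simp only [Pi.one_apply, ofReal_one, one_mul, Finset.prod_mul_distrib, Finset.prod_const,
    Finset.card_univ, Fintype.card_fin, smul_eq_mul, Finset.prod_inv_distrib, mul_pow, mul_inv]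
  have h1 : ∏ i, x i ≠ 0 := Finset.prod_ne_zero_iff.2 fun i _ => h0 i
  have h2 : (I : ℂ) ^ n ≠ 0 := pow_ne_zero _ I_ne_zero
  field_simp

theorem IsCircleSum.continuous_weylIntegrand {g : ℂ → ℂ} {c : PowerSeries ℂ}
    (h : IsCircleSum g c) (f : MvPolynomial (Fin n) ℂ) :
    Continuous fun θ : Fin n → ℝ => weylIntegrand g f fun i => exp (θ i * I) := by
  have h1 : Continuous fun θ : Fin n → ℝ => fun i => exp (θ i * I) := by fun_prop
  have h2 : ∀ i, Continuous fun θ : Fin n → ℝ => (exp (θ i * I))⁻¹ := fun i =>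
    Continuous.inv₀ (by fun_prop) fun θ => exp_ne_zero _
  have h3 : ∀ i, Continuous fun θ : Fin n → ℝ => g (exp (θ i * I)) := fun i =>
    h.continuous.comp (continuous_apply i)
  simp only [weylIntegrand, alternant_eq_sum]
  exact ((((MvPolynomial.continuous_eval f).comp h1).mul (by fun_prop)).mul (by fun_prop)).mul
    (continuous_finsetProd _ fun i _ => h3 i)

/-- With S_μ a_δ replaced by a_{μ+δ}, both alternants are expanded, over σ and τ, and every term
integrates as a product. The sum over τ is the determinant with rows permuted by σ; its sign cancels
the sign from a_{μ+δ}, leaving n! equal contributions. -/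
theorem IsCircleSum.integral_weylIntegrand_schurPoly {g : ℂ → ℂ} {c : PowerSeries ℂ}
    (h : IsCircleSum g c) {μ : YoungDiagram} (hμ : μ.colLen 0 ≤ n) :
    ∫ θ : Fin n → ℝ in Set.Icc 0 fun _ => 2 * Real.pi,
      weylIntegrand g (schurPoly n μ) (fun i => exp (θ i * I)) =
        (2 * Real.pi) ^ n * n.factorial * jacobiTrudi c (⇑(weight n μ) + stair n) := by
  set α := ⇑(weight n μ) + stair n with hα
  have hS : ∀ x : Fin n → ℂ, eval x (schurPoly n μ) * alternant x (stair n) = alternant x α := by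
    intro x
    have := congrArg (eval x) (schurPoly_mul_alternant hμ)
    rw [map_mul, map_alternant, map_alternant] at this
    simpa using this
  have hexp : ∀ x : Fin n → ℂ, weylIntegrand g (schurPoly n μ) x =
      ∑ σ : Equiv.Perm (Fin n), ∑ τ : Equiv.Perm (Fin n),
        ((Equiv.Perm.sign σ : ℂ) * (Equiv.Perm.sign τ : ℂ)) *
          ∏ i, x i ^ α (σ i) * ((x i)⁻¹ ^ stair n (τ i) * g (x i)) := by
    intro x
    rw [weylIntegrand, hS, alternant_eq_sum, alternant_eq_sum, Finset.sum_mul_sum, Finset.sum_mul]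
    refine Finset.sum_congr rfl fun σ _ => ?_
    rw [Finset.sum_mul]
    refine Finset.sum_congr rfl fun τ _ => ?_
    simp only [Finset.prod_mul_distrib]
    ring
  have hterm : ∀ τ : Equiv.Perm (Fin n), ∀ i, IsCircleSum (fun x => x⁻¹ ^ stair n (τ i) * g x)
      (PowerSeries.X ^ stair n (τ i) * c) := fun τ i => (isCircleSum_X_pow _).mul h
  have hcont : ∀ σ τ : Equiv.Perm (Fin n), Continuous fun θ : Fin n → ℝ =>
      ((Equiv.Perm.sign σ : ℂ) * (Equiv.Perm.sign τ : ℂ)) * ∏ i, exp (θ i * I) ^ α (σ i) *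
        ((exp (θ i * I))⁻¹ ^ stair n (τ i) * g (exp (θ i * I))) := by
    intro σ τ
    have := fun i => (hterm τ i).continuous.comp (continuous_apply (A := fun _ : Fin n => ℝ) i)
    simp only [Function.comp_def] at this
    fun_prop
  have hdet : ∀ σ : Equiv.Perm (Fin n), ∑ τ : Equiv.Perm (Fin n), (Equiv.Perm.sign τ : ℂ) *
      ∏ i, PowerSeries.coeff (α (σ i)) (PowerSeries.X ^ stair n (τ i) * c) =
        jacobiTrudi c (α ∘ σ) := by
    intro σ
    rw [jacobiTrudi, ← Matrix.det_transpose, Matrix.det_apply']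
    rfl
  simp only [hexp]
  rw [integral_finsetSum _ fun σ _ => (continuous_finsetSum _ fun τ _ =>
    hcont σ τ).integrableOn_Icc]
  have hσ : ∀ σ : Equiv.Perm (Fin n), ∫ θ : Fin n → ℝ in Set.Icc 0 fun _ => 2 * Real.pi,
      ∑ τ : Equiv.Perm (Fin n), ((Equiv.Perm.sign σ : ℂ) * (Equiv.Perm.sign τ : ℂ)) *
        ∏ i, exp (θ i * I) ^ α (σ i) * ((exp (θ i * I))⁻¹ ^ stair n (τ i) * g (exp (θ i * I))) =
      (2 * Real.pi) ^ n * jacobiTrudi c α := by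
    intro σ
    rw [integral_finsetSum _ fun τ _ => (hcont σ τ).integrableOn_Icc]
    have hτ : ∀ τ : Equiv.Perm (Fin n), ∫ θ : Fin n → ℝ in Set.Icc 0 fun _ => 2 * Real.pi,
        ((Equiv.Perm.sign σ : ℂ) * (Equiv.Perm.sign τ : ℂ)) * ∏ i, exp (θ i * I) ^ α (σ i) *
          ((exp (θ i * I))⁻¹ ^ stair n (τ i) * g (exp (θ i * I))) =
        ((2 * Real.pi) ^ n * (Equiv.Perm.sign σ : ℂ)) * ((Equiv.Perm.sign τ : ℂ) *
          ∏ i, PowerSeries.coeff (α (σ i)) (PowerSeries.X ^ stair n (τ i) * c)) := by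
      intro τ
      rw [integral_const_mul, IsCircleSum.integral_prod (hterm τ) fun i => α (σ i)]
      ring
    rw [Finset.sum_congr rfl fun τ _ => hτ τ, ← Finset.mul_sum, hdet, jacobiTrudi_perm]
    have hs : ((Equiv.Perm.sign σ : ℤ) : ℂ) * ((Equiv.Perm.sign σ : ℤ) : ℂ) = 1 := by
      rw [← Int.cast_mul, ← Units.val_mul, Int.units_mul_self]
      simp
    rw [mul_assoc, ← mul_assoc ((Equiv.Perm.sign σ : ℤ) : ℂ), hs, one_mul]
  rw [Finset.sum_congr rfl fun σ _ => hσ σ, Finset.sum_const, Finset.card_univ,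
    Fintype.card_perm, Fintype.card_fin, nsmul_eq_mul]
  ring

/-- Integration against the Weyl measure computes Jacobi–Trudi determinants. -/
theorem IsCircleSum.weylIntegral_eq_sum {g : ℂ → ℂ} {c : PowerSeries ℂ} (h : IsCircleSum g c)
    (f : symmetricSubalgebra (Fin n) ℂ) :
    weylIntegral n (fun x => eval x (f : MvPolynomial (Fin n) ℂ) * ∏ i, g (x i)) =
      (schurBasis n).constr ℂ
        (fun μ => jacobiTrudi c (⇑(weight n μ.1) + stair n)) f := by
  have hadd : ∀ p q : MvPolynomial (Fin n) ℂ, ∀ x, weylIntegrand g (p + q) x =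
      weylIntegrand g p x + weylIntegrand g q x := fun p q x => by
    simp only [weylIntegrand, map_add]
    ring
  have hsmul : ∀ (a : ℂ) (p : MvPolynomial (Fin n) ℂ) x, weylIntegrand g (a • p) x =
      a * weylIntegrand g p x := fun a p x => by
    simp only [weylIntegrand, smul_eval]
    ring
  -- The integral as a linear functional of `f`, so that it can be compared on the Schur basis;
  -- additivity needs integrability, which continuity on the box provides.
  let J : symmetricSubalgebra (Fin n) ℂ →ₗ[ℂ] ℂ :=
    { toFun := fun f => ((2 * Real.pi) ^ n * n.factorial : ℂ)⁻¹ *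
        ∫ θ : Fin n → ℝ in Set.Icc 0 fun _ => 2 * Real.pi,
          weylIntegrand g (f : MvPolynomial (Fin n) ℂ) fun i => exp (θ i * I)
      map_add' := fun p q => by
        simp only [Subalgebra.coe_add, hadd]
        rw [integral_add (h.continuous_weylIntegrand _).integrableOn_Icc
          (h.continuous_weylIntegrand _).integrableOn_Icc, mul_add]
      map_smul' := fun a p => by
        simp only [Subalgebra.coe_smul, hsmul, integral_const_mul, smul_eq_mul, RingHom.id_apply]
        ring }
  have hJ : J = (schurBasis n).constr ℂ
      (fun μ => jacobiTrudi c (⇑(weight n μ.1) + stair n)) := by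
    refine (schurBasis n).ext fun μ => ?_
    rw [Module.Basis.constr_basis]
    change _ * (∫ θ : Fin n → ℝ in Set.Icc 0 fun _ => 2 * Real.pi,
      weylIntegrand g (schurBasis n μ : MvPolynomial (Fin n) ℂ) fun i => exp (θ i * I)) = _
    rw [schurBasis_apply, h.integral_weylIntegrand_schurPoly μ.2, inv_mul_cancel_left₀]
    exact mul_ne_zero (pow_ne_zero _ (by simp [Real.pi_ne_zero]))
      (Nat.cast_ne_zero.2 n.factorial_ne_zero)
  rw [weylIntegral_eq, ← hJ]
  rfl

end WeylIntegral

/-! ### The integral formula -/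

theorem isCircleSum_hookSeries {k l : ℕ} {y : Fin k → ℂ} (z : Fin l → ℂ) (hy : ∀ j, ‖y j‖ < 1) :
    IsCircleSum (fun x => (∏ j, (1 + z j * x⁻¹)) * ∏ j, (1 - y j * x⁻¹)⁻¹)
      (hookSeries (Sum.elim y z)) :=
  (isCircleSum_prod _ fun j => isCircleSum_one_add (z j)).mul
    (isCircleSum_prod _ fun j => isCircleSum_geometric (hy j))

/-- Taking x out of the l factors above and the k factors below cancels x^{k-l} and leaves K(x⁻¹).
-/
theorem zpow_mul_prod_div_eq {k l : ℕ} (y : Fin k → ℂ) (z : Fin l → ℂ) {x : ℂ} (hx : x ≠ 0) :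
    x ^ ((k : ℤ) - (l : ℤ)) * ((∏ j, (x + z j)) / ∏ j, (x - y j)) =
      (∏ j, (1 + z j * x⁻¹)) * ∏ j, (1 - y j * x⁻¹)⁻¹ := by
  have hz : ∏ j, (x + z j) = x ^ l * ∏ j, (1 + z j * x⁻¹) := by
    have : ∀ j, x + z j = x * (1 + z j * x⁻¹) := fun j => by field_simp
    simp only [this, Finset.prod_mul_distrib, Finset.prod_const, Finset.card_univ,
      Fintype.card_fin]
  have hy : ∏ j, (x - y j) = x ^ k * ∏ j, (1 - y j * x⁻¹) := by
    have : ∀ j, x - y j = x * (1 - y j * x⁻¹) := fun j => by field_simp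
    simp only [this, Finset.prod_mul_distrib, Finset.prod_const, Finset.card_univ,
      Fintype.card_fin]
  rw [hz, hy, Finset.prod_inv_distrib, mul_div_mul_comm, zpow_sub₀ hx, zpow_natCast, zpow_natCast,
    ← mul_assoc, div_mul_div_comm, mul_comm (x ^ l), div_self, one_mul, div_eq_mul_inv]
  exact mul_ne_zero (pow_ne_zero _ hx) (pow_ne_zero _ hx)

/-- Only the values on the torus matter for `weylIntegral`. -/
theorem weylIntegral_congr {n : ℕ} {g g' : (Fin n → ℂ) → ℂ}
    (h : ∀ x : Fin n → ℂ, (∀ i, ‖x i‖ = 1) → g x = g' x) :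
    weylIntegral n g = weylIntegral n g' := by
  unfold weylIntegral torusIntegral
  congr 1
  funext θ
  have := h (torusMap 0 1 θ) fun i => by simp [torusMap, Complex.norm_exp_ofReal_mul_I]
  simp only [this]

theorem eval_digamma {n k l : ℕ} (f : symmetricSubalgebra (Fin n) ℂ) (w : Fin k ⊕ Fin l → ℂ) :
    eval w (digamma n k l f) = (schurBasis n).constr ℂ
      (fun μ => jacobiTrudi (hookSeries w) (⇑(weight n μ.1) + stair n)) f := by
  have h : (aeval w).toLinearMap ∘ₗ digamma n k l = (schurBasis n).constr ℂ
      (fun μ => jacobiTrudi (hookSeries w) (⇑(weight n μ.1) + stair n)) := by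
    refine (schurBasis n).ext fun μ => ?_
    rw [Module.Basis.constr_basis, LinearMap.comp_apply, digamma, Module.Basis.constr_basis,
      AlgHom.toLinearMap_apply, aeval_eq_eval, map_hookSchur _ μ.2]
    simp
  exact congrArg (fun g => g f) h

end HookSchur

theorem theorem2p12 (n k l : ℕ) (f : MvPolynomial (Fin n) ℂ) (hf : f.IsSymmetric) :
    (HookSchur.digamma n k l ⟨f, hf⟩ : MvPowerSeries (Fin k ⊕ Fin l) ℂ) =
        HookSchur.kernelPairing n k l ⟨f, hf⟩ ∧
      ∀ (y : Fin k → ℂ) (z : Fin l → ℂ), (∀ j, ‖y j‖ < 1) →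
        MvPolynomial.eval (Sum.elim y z) (HookSchur.digamma n k l ⟨f, hf⟩) =
          HookSchur.weylIntegral n fun x =>
            MvPolynomial.eval x f *
              ((∏ i, x i ^ ((k : ℤ) - (l : ℤ))) *
                ((∏ i, ∏ j, (x i + z j)) / ∏ i, ∏ j, (x i - y j))) := by
  refine ⟨HookSchur.coe_digamma_eq_kernelPairing _, fun y z hy => ?_⟩
  rw [HookSchur.eval_digamma,
    ← (HookSchur.isCircleSum_hookSeries z hy).weylIntegral_eq_sum ⟨f, hf⟩]
  -- The two integrands are compared on the torus only, where no x_i vanishes.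
  refine HookSchur.weylIntegral_congr fun x hx => ?_
  rw [← Finset.prod_div_distrib, ← Finset.prod_mul_distrib]
  congr 1
  refine Finset.prod_congr rfl fun i _ => (HookSchur.zpow_mul_prod_div_eq y z fun h => ?_).symm
  have := hx i
  rw [h, norm_zero] at this
  exact zero_ne_one this
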